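/- **Lemma 2.3 (sub-additivity).** Let $N\ge 1$, $m\ge 2$, $\alpha>N/2$. All function spaces consist of real-valued functions on $\mathbb R^N$, and $\Lambda^\alpha=(-\Delta)^{\alpha/2}$ is the Fourier multiplier with symbol $|\xi|^{\alpha}$, normalized so that $\Lambda^2=-\Delta$. A function $G:\mathbb R^N\times V\to\mathbb R$ is called *periodic* if there is $L\in\mathbb R^N\setminus\{0\}$ with $G(x+L,v)=G(x,v)$ for all $x,v$. For a Carathéodory function $F:\mathbb R^N\times\mathbb R^m\to\mathbb R$ and $c\in(0,\infty)^m$ put $$J_F(\mathbf u)=\frac12\int_{\mathbb R^N}\sum_{i=1}^m|\Lambda^\alpha u_i|^2dx-\int_{\mathbb R^N}F(x,\mathbf u(x))\,dx,\qquad I^F_c=\inf\{J_F(\mathbf u):\mathbf u\in S_c\}\in[-\infty,\infty),$$ $$S_c=\Big\{\mathbf u\in H^\alpha(\mathbb R^N)^m:\int_{\mathbb R^N}|u_i|^2dx=c_i,\ 1\le i\le m\Big\}.$$ Consider the following conditions on $F$. In $(H_1)$ and $(H_5)$ it is understood that the partial derivatives $\partial_jF=\partial F/\partial u_j$ exist everywhere.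 * $(H_1)$ There are $A,B>0$ and $0<l_i<\frac{4\alpha}{N}$ such that for all $x\in\mathbb R^N$, $\mathbf u\in\mathbb R^m$, $1\le j\le m$: $0\le F(x,\mathbf u)\le A\big(\sum_i|u_i|^2+\sum_i|u_i|^{l_i+2}\big)$ and $\partial_jF(x,\mathbf u)\le B\big(\sum_i|u_i|+\sum_i|u_i|^{l_i+1}\big)$. * $(H_2)$ There are $\beta,S,R>0$, $s_1,\dots,s_m>0$ with sum $s$, and $t\in[0,2)$ with $t<N\big(1-\frac s2\big)+2\alpha$, such that $F(x,\mathbf u)>\beta|x|^{-t}|u_1|^{s_1}\cdots|u_m|^{s_m}$ whenever $|x|\ge R$, $\sum_i|u_i|^2<S$ and $u_i\neq0$ for all $i$. * $(H_3)$ For every $j\in\{1,\dots,m\}$ one can write $F(x,\mathbf u)=F_{1j}(x,\mathbf u)+F_{2j}(x,u_1,\dots,u_{j-1},u_{j+1},\dots,u_m)$, where $F_{1j}(x,\mathbf u)=0$ if $u_j=0$, where $F_{1j}(x,u_1,\dots,\theta u_j,\dots,u_m)\ge\theta^2F_{1j}(x,\mathbf u)$ for all $x,\mathbf u$ and $\theta\ge1$,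 and where $F_{2j}$ is periodic. * $(H_5)$ There are $A',B'>0$ and $0<\beta'_i<l_i<\frac{4\alpha}{N}$ such that for all $x,\mathbf u,j$: $0\le F(x,\mathbf u)\le A'\big(\sum_i|u_i|^{\beta'_i+2}+\sum_i|u_i|^{l_i+2}\big)$ and $\partial_jF(x,\mathbf u)\le B'\big(\sum_i|u_i|^{\beta'_i+1}+\sum_i|u_i|^{l_i+1}\big)$. * $(H_6)$ There is $\sigma>0$, and for every $j\in\{1,\dots,m\}$ one can write $F(x,\mathbf u)=F_{1j}(x,\mathbf u)+F_{2j}(x,\mathbf u)+F_{3j}(x,u_1,\dots,u_{j-1},u_{j+1},\dots,u_m)$, where $F_{1j}\ge0$, where $F_{2j}(x,\mathbf u)=0$ if $u_j=0$, where for all $x,\mathbf u$ and $\theta\ge1$ $$F_{1j}(x,u_1,\dots,\theta u_j,\dots,u_m)\ge\theta^{2+\sigma}F_{1j}(x,\mathbf u),\qquad F_{2j}(x,u_1,\dots,\theta u_j,\dots,u_m)\ge\theta^2F_{2j}(x,\mathbf u),$$ and where $F_{3j}$ is periodic; moreover there is $C>0$ with $F(x,\mathbf u)\le C\sum_{j=1}^mF_{1j}(x,\mathbf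 u)$ for all $x,\mathbf u$. Then: 1. If $F$ is a Carathéodory function satisfying $(H_1)$, $(H_2)$ and $(H_3)$, then with $I_c=I^F_c$, $$I_{c}\le I_{a}+I_{c-a}\qquad\text{for all } a,c\in(0,\infty)^m\text{ with }0<a_i<c_i\ (1\le i\le m).$$ 2. If $F^\infty$ is a periodic Carathéodory function satisfying $(H_2)$, $(H_5)$ and $(H_6)$, then with $I^\infty_c=I^{F^\infty}_c$, $$I^\infty_{c}<I^\infty_{a}+I^\infty_{c-a}\qquad\text{for all } a,c\in(0,\infty)^m\text{ with }0<a_i<c_i\ (1\le i\le m).$$ -/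

import Mathlib

noncomputable section

open MeasureTheory FourierTransform
open scoped ENNReal

namespace FracSystem

/-- The space `ℝ^N` with its Euclidean norm and Lebesgue measure. -/
abbrev RN (N : ℕ) := EuclideanSpace ℝ (Fin N)

/-- Real-valued `L²` functions on `ℝ^N`. -/
abbrev L2 (N : ℕ) := Lp ℝ 2 (volume : Measure (RN N))

/-- A real-valued `L²` function regarded as a complex-valued one. -/
def complexify {N : ℕ} (u : L2 N) : Lp ℂ 2 (volume : Measure (RN N)) :=
  Complex.ofRealCLM.compLp u

/-- `u ∈ H^α(ℝ^N)`, with `u` real-valued. -/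
def MemH {N : ℕ} (α : ℝ) (u : L2 N) : Prop :=
  TemperedDistribution.MemSobolev α 2
    (Lp.toTemperedDistribution (complexify u))

open Classical in
/-- `Λ^α u` for `Λ = (-Δ)^{1/2}` and `u ∈ H^α(ℝ^N)`: the `L²` function whose Fourier transform is
`|ξ|^α û(ξ)`. In the normalization `û(ξ) = ∫ e^{-2πi⟨x,ξ⟩} u(x) dx` used here, the symbol of `Λ^α`
is `(2π|ξ|)^α`. The value `0` is assigned to those `u ∈ L²` for which `|ξ|^α û` is not in `L²`,
that is, outside `H^α(ℝ^N)` when `α ≥ 0`. -/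
def Lam {N : ℕ} (α : ℝ) (u : L2 N) : Lp ℂ 2 (volume : Measure (RN N)) :=
  if h : MemLp (fun ξ : RN N =>
      (((2 * Real.pi * ‖ξ‖) ^ α : ℝ) : ℂ) *
        ((𝓕 (complexify u) : Lp ℂ 2 (volume : Measure (RN N))) : RN N → ℂ) ξ) 2 volume
  then 𝓕⁻ (h.toLp _) else 0

section

open TemperedDistribution
open scoped SchwartzMap ContDiff

/-- A distributional identity `g v = f` between `L²` functions is an identity almost everywhere. -/
theorem smulLeft_eq_iff {N : ℕ} {g : RN N → ℂ} (hg : g.HasTemperateGrowth)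
    (v f : Lp ℂ 2 (volume : Measure (RN N))) :
    smulLeftCLM ℂ g (Lp.toTemperedDistribution v) = Lp.toTemperedDistribution f ↔
      (fun ξ => g ξ * v ξ) =ᵐ[volume] f := by
  constructor
  · intro h
    have hgc : Continuous g := hg.1.continuous
    have hv : LocallyIntegrable v volume := (Lp.memLp v).locallyIntegrable (by norm_num)
    have hf : LocallyIntegrable f volume := (Lp.memLp f).locallyIntegrable (by norm_num)
    have hgv : LocallyIntegrable (fun ξ => g ξ * v ξ) volume := by
      have := (hv.locallyIntegrableOn Set.univ).continuousOn_smul isOpen_univ.isLocallyClosed hgc.continuousOn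
      simpa [locallyIntegrableOn_univ] using this
    have : ∀ᵐ x ∂(volume : Measure (RN N)), (fun ξ => g ξ * v ξ - f ξ) x = 0 := by
      apply ae_eq_zero_of_integral_contDiff_smul_eq_zero (hgv.sub hf)
      intro φ hs hc
      have hg₁ : HasCompactSupport (Complex.ofRealCLM ∘ φ) := hc.comp_left rfl
      have hg₂ : ContDiff ℝ ∞ (Complex.ofRealCLM ∘ φ) := by fun_prop
      have h2 := congrArg (fun T => T (hg₁.toSchwartzMap hg₂)) h
      simp [Lp.toTemperedDistribution_apply, hg] at h2
      have e1 := hgv.integrable_smul_left_of_hasCompactSupport hs.continuous hc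
      have e2 := hf.integrable_smul_left_of_hasCompactSupport hs.continuous hc
      have : ∀ x, φ x • (g x * v x - f x) = φ x • (g x * v x) - φ x • f x := fun x => smul_sub _ _ _
      refine (integral_congr_ae (Filter.Eventually.of_forall this)).trans ?_
      rw [integral_sub e1 e2, sub_eq_zero]
      simpa [mul_assoc, mul_left_comm] using! h2
    filter_upwards [this] with x hx
    exact sub_eq_zero.mp hx
  · intro h
    ext φ
    simp only [smulLeftCLM_apply_apply, Lp.toTemperedDistribution_apply]
    apply integral_congr_ae
    filter_upwards [h] with x hx
    simp [hg, ← hx]; ring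

/-- For `α ≥ 0`, `u ∈ H^α(ℝ^N)` exactly when `u ∈ L²` and `|ξ|^α û ∈ L²`. In particular the
exceptional value in the definition of `Lam` does not occur on `H^α(ℝ^N)`. -/
theorem memH_iff {N : ℕ} {α : ℝ} (hα : 0 ≤ α) (u : L2 N) :
    MemH α u ↔ MemLp (fun ξ : RN N =>
      (((2 * Real.pi * ‖ξ‖) ^ α : ℝ) : ℂ) *
        ((𝓕 (complexify u) : Lp ℂ 2 (volume : Measure (RN N))) : RN N → ℂ) ξ) 2 volume := by
  unfold MemH
  rw [memSobolev_iff_exists_smulLeftCLM_fourier, Lp.fourier_toTemperedDistribution_eq]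
  set v := (𝓕 (complexify u) : Lp ℂ 2 (volume : Measure (RN N)))
  have hv := Lp.memLp v
  have hw : Function.HasTemperateGrowth
    (fun x : RN N ↦ (((1 + ‖x‖ ^ 2) ^ (α / 2) : ℝ) : ℂ)) := by fun_prop
  have key : (∃ f' : Lp ℂ 2 (volume : Measure (RN N)),
      smulLeftCLM ℂ (fun x ↦ (((1 + ‖x‖ ^ 2) ^ (α / 2) : ℝ) : ℂ)) (Lp.toTemperedDistribution v)
        = Lp.toTemperedDistribution f') ↔
      MemLp (fun ξ : RN N => (((1 + ‖ξ‖ ^ 2) ^ (α / 2) : ℝ) : ℂ) * v ξ) 2 volume := by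
    constructor
    · rintro ⟨f, hf⟩
      exact (memLp_congr_ae ((smulLeft_eq_iff hw v f).1 hf)).2 (Lp.memLp f)
    · intro h
      exact ⟨h.toLp _, (smulLeft_eq_iff hw v _).2 h.coeFn_toLp.symm⟩
  rw [key]
  have m1 : AEStronglyMeasurable (fun ξ : RN N =>
      (((2 * Real.pi * ‖ξ‖) ^ α : ℝ) : ℂ) * v ξ) volume := by
    refine AEStronglyMeasurable.mul ?_ hv.1
    exact (Complex.measurable_ofReal.comp (by fun_prop)).aestronglyMeasurable
  have m2 : AEStronglyMeasurable (fun ξ : RN N =>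
      (((1 + ‖ξ‖ ^ 2) ^ (α / 2) : ℝ) : ℂ) * v ξ) volume :=
    AEStronglyMeasurable.mul hw.1.continuous.aestronglyMeasurable hv.1
  have hsq : ∀ ξ : RN N, ‖ξ‖ ^ α ≤ (1 + ‖ξ‖ ^ 2) ^ (α / 2) := by
    intro ξ
    have : ‖ξ‖ ^ α = (‖ξ‖ ^ 2) ^ (α / 2) := by
      rw [← Real.rpow_natCast, ← Real.rpow_mul (norm_nonneg _)]; congr 1; push_cast; ring
    rw [this]
    exact Real.rpow_le_rpow (by positivity) (by linarith) (by positivity)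
  have hsq' : ∀ ξ : RN N, (1 + ‖ξ‖ ^ 2) ^ (α / 2) ≤ 2 ^ (α / 2) * (1 + ‖ξ‖ ^ α) := by
    intro ξ
    have e : ‖ξ‖ ^ α = (‖ξ‖ ^ 2) ^ (α / 2) := by
      rw [← Real.rpow_natCast, ← Real.rpow_mul (norm_nonneg _)]; congr 1; push_cast; ring
    have hp : (0:ℝ) < 2 ^ (α / 2) := by positivity
    rcases le_total (‖ξ‖ ^ 2) 1 with h | h
    · calc (1 + ‖ξ‖ ^ 2) ^ (α / 2) ≤ 2 ^ (α / 2) :=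
            Real.rpow_le_rpow (by positivity) (by linarith) (by positivity)
        _ ≤ _ := by
          have : 0 ≤ ‖ξ‖ ^ α := by positivity
          nlinarith
    · calc (1 + ‖ξ‖ ^ 2) ^ (α / 2) ≤ (2 * ‖ξ‖ ^ 2) ^ (α / 2) :=
            Real.rpow_le_rpow (by positivity) (by linarith) (by positivity)
        _ = 2 ^ (α / 2) * ‖ξ‖ ^ α := by rw [Real.mul_rpow (by positivity) (by positivity), e]
        _ ≤ _ := by nlinarith
  have hC : ∀ ξ : RN N, (2 * Real.pi * ‖ξ‖) ^ α = (2 * Real.pi) ^ α * ‖ξ‖ ^ α := fun ξ =>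
    Real.mul_rpow (by positivity) (by positivity)
  have hpi : (0:ℝ) < (2 * Real.pi) ^ α := by positivity
  constructor
  · intro h
    refine h.of_le_mul (c := (2 * Real.pi) ^ α) m1 (Filter.Eventually.of_forall fun ξ => ?_)
    rw [norm_mul, norm_mul, Complex.norm_real, Complex.norm_real, Real.norm_of_nonneg (by positivity),
      Real.norm_of_nonneg (by positivity), hC, ← mul_assoc]
    gcongr
    exact hsq ξ
  · intro h
    have hs : MemLp (fun ξ : RN N => ‖v ξ‖ + ‖(((2 * Real.pi * ‖ξ‖) ^ α : ℝ) : ℂ) * v ξ‖) 2 volume :=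
      hv.norm.add h.norm
    refine hs.of_le_mul (c := 2 ^ (α / 2) * (1 + ((2 * Real.pi) ^ α)⁻¹)) m2
      (Filter.Eventually.of_forall fun ξ => ?_)
    rw [norm_mul, norm_mul, Complex.norm_real, Complex.norm_real, Real.norm_of_nonneg (by positivity),
      Real.norm_of_nonneg (by positivity), hC, Real.norm_of_nonneg (by positivity)]
    have hx : 0 ≤ ‖ξ‖ ^ α := by positivity
    have h1 : (1 + ‖ξ‖ ^ α) ≤ (1 + ((2 * Real.pi) ^ α)⁻¹) * (1 + (2 * Real.pi) ^ α * ‖ξ‖ ^ α) := by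
      have : ((2 * Real.pi) ^ α)⁻¹ * ((2 * Real.pi) ^ α * ‖ξ‖ ^ α) = ‖ξ‖ ^ α := by field_simp
      have h3 : 0 < ((2 * Real.pi) ^ α)⁻¹ := by positivity
      nlinarith [mul_nonneg hpi.le hx]
    calc _ ≤ 2 ^ (α / 2) * (1 + ‖ξ‖ ^ α) * ‖v ξ‖ := by gcongr; exact hsq' ξ
      _ ≤ 2 ^ (α / 2) * ((1 + ((2 * Real.pi) ^ α)⁻¹) * (1 + (2 * Real.pi) ^ α * ‖ξ‖ ^ α)) * ‖v ξ‖ := by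
          gcongr
      _ = _ := by ring

end

/-- The constraint set `S_c`. -/
def S {N m : ℕ} (α : ℝ) (c : Fin m → ℝ) : Set (Fin m → L2 N) :=
  {u | (∀ i, MemH α (u i)) ∧ ∀ i, ∫ x, |u i x| ^ 2 = c i}

/-- The energy `J(u) = ½ ∫ ∑ |Λ^α u_i|² - ∫ F(x, u(x))`. -/
def J {N m : ℕ} (α : ℝ) (F : RN N → (Fin m → ℝ) → ℝ) (u : Fin m → L2 N) : ℝ :=
  1 / 2 * (∫ x, ∑ i, ‖Lam α (u i) x‖ ^ 2) - ∫ x, F x (fun i => u i x)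

/-- The constrained infimum `I_c = inf {J(u) : u ∈ S_c}`, as an extended real number. -/
def I {N m : ℕ} (α : ℝ) (F : RN N → (Fin m → ℝ) → ℝ) (c : Fin m → ℝ) : EReal :=
  ⨅ u ∈ S (N := N) α c, ((J α F u : ℝ) : EReal)

/-- Carathéodory functions: Lebesgue measurable in `x`, continuous in `u` for almost every `x`. -/
def Caratheodory {N m : ℕ} (F : RN N → (Fin m → ℝ) → ℝ) : Prop :=
  (∀ u, AEMeasurable (fun x => F x u) volume) ∧ ∀ᵐ x, Continuous (F x)

/-- Existence of all the partial derivatives `∂F/∂u_j`. -/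
def HasPartials {N m : ℕ} (F : RN N → (Fin m → ℝ) → ℝ) : Prop :=
  ∀ x u j, DifferentiableAt ℝ (fun s => F x (Function.update u j s)) (u j)

/-- The partial derivative `∂F/∂u_j (x, u)`. -/
def partialDeriv {N m : ℕ} (F : RN N → (Fin m → ℝ) → ℝ) (j : Fin m)
    (x : RN N) (u : Fin m → ℝ) : ℝ :=
  deriv (fun s => F x (Function.update u j s)) (u j)

/-- Periodicity in `x`, with a nonzero period. -/
def Periodic {N : ℕ} {V : Type*} (G : RN N → V → ℝ) : Prop :=
  ∃ L : RN N, L ≠ 0 ∧ ∀ x v, G (x + L) v = G x v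

/-- Growth assumption on `F`. -/
def H1 {N m : ℕ} (α : ℝ) (F : RN N → (Fin m → ℝ) → ℝ) : Prop :=
  HasPartials F ∧ ∃ A > 0, ∃ B > 0, ∃ l : Fin m → ℝ,
    (∀ i, 0 < l i ∧ l i < 4 * α / N) ∧
    ∀ x u, 0 ≤ F x u ∧
      F x u ≤ A * (∑ i, |u i| ^ 2 + ∑ i, |u i| ^ (l i + 2)) ∧
      ∀ j, partialDeriv F j x u ≤ B * (∑ i, |u i| + ∑ i, |u i| ^ (l i + 1))

/-- Lower bound on `F` near infinity in `x` and near the origin in `u`. -/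
def H2 {N m : ℕ} (α : ℝ) (F : RN N → (Fin m → ℝ) → ℝ) : Prop :=
  ∃ β > 0, ∃ S > 0, ∃ R > 0, ∃ s : Fin m → ℝ, ∃ t : ℝ,
    (∀ i, 0 < s i) ∧ 0 ≤ t ∧ t < 2 ∧ t < N * (1 - (∑ i, s i) / 2) + 2 * α ∧
    ∀ (x : RN N) (u : Fin m → ℝ), R ≤ ‖x‖ → ∑ i, |u i| ^ 2 < S → (∀ i, u i ≠ 0) →
      β * ‖x‖ ^ (-t) * ∏ i, |u i| ^ s i < F x u

/-- Splitting `F = F_{1j} + F_{2j}`, for each `j`, into a part that vanishes with `u_j` and grows at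
least quadratically in `u_j`, and a part that is independent of `u_j` and periodic in `x`. -/
def H3 {N m : ℕ} (F : RN N → (Fin m → ℝ) → ℝ) : Prop :=
  ∀ j : Fin m, ∃ (F1 : RN N → (Fin m → ℝ) → ℝ) (F2 : RN N → ({i : Fin m // i ≠ j} → ℝ) → ℝ),
    (∀ x u, F x u = F1 x u + F2 x (fun i => u i)) ∧
    (∀ x u, u j = 0 → F1 x u = 0) ∧
    (∀ x u θ, 1 ≤ θ → θ ^ 2 * F1 x u ≤ F1 x (Function.update u j (θ * u j))) ∧
    Periodic F2

/-- Growth assumption on `F^∞`. -/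
def H5 {N m : ℕ} (α : ℝ) (F : RN N → (Fin m → ℝ) → ℝ) : Prop :=
  HasPartials F ∧ ∃ A > 0, ∃ B > 0, ∃ b l : Fin m → ℝ,
    (∀ i, 0 < b i ∧ b i < l i ∧ l i < 4 * α / N) ∧
    ∀ x u, 0 ≤ F x u ∧
      F x u ≤ A * (∑ i, |u i| ^ (b i + 2) + ∑ i, |u i| ^ (l i + 2)) ∧
      ∀ j, partialDeriv F j x u ≤ B * (∑ i, |u i| ^ (b i + 1) + ∑ i, |u i| ^ (l i + 1))

/-- Splitting `F^∞ = F^∞_{1j} + F^∞_{2j} + F^∞_{3j}`, for each `j`: the first two parts vanish with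
`u_j` (for the first one this follows from its sign and growth) and grow in `u_j` at least with
the powers `2 + σ` and `2`; the third part is independent of `u_j` and periodic in `x`. -/
def H6 {N m : ℕ} (F : RN N → (Fin m → ℝ) → ℝ) : Prop :=
  ∃ (F1 F2 : Fin m → RN N → (Fin m → ℝ) → ℝ)
    (F3 : (j : Fin m) → RN N → ({i : Fin m // i ≠ j} → ℝ) → ℝ) (σ : ℝ), 0 < σ ∧
    (∀ j x u, F x u = F1 j x u + F2 j x u + F3 j x (fun i => u i)) ∧
    (∀ j x u, 0 ≤ F1 j x u) ∧
    (∀ j x u, u j = 0 → F2 j x u = 0) ∧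
    (∀ j x u θ, 1 ≤ θ → θ ^ (2 + σ) * F1 j x u ≤ F1 j x (Function.update u j (θ * u j))) ∧
    (∀ j x u θ, 1 ≤ θ → θ ^ 2 * F2 j x u ≤ F2 j x (Function.update u j (θ * u j))) ∧
    (∀ j, Periodic (F3 j)) ∧
    ∃ C > 0, ∀ x u, F x u ≤ C * ∑ j, F1 j x u

end FracSystem

end

noncomputable section

open MeasureTheory FourierTransform Filter Topology
open scoped ENNReal SchwartzMap ContDiff

namespace FracSystem

/-! Almost minimizers `u` (masses `a`) and `v` (masses `c - a`) are merged into one competitor with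
masses `c`. The obstacle is that `Λ^α` is nonlocal, and that `F` itself need not be periodic in part
1, so `v` cannot simply be translated to infinity. Both difficulties disappear once, for each index,
at most one of the two configurations has a nonzero component.

Rounding (`exists_round`). Let `u_j`, `v_j` have masses `p`, `q`. Dilating `u_j` by `θ` with `θ² =
(p + q) / p` and deleting `v_j`, or deleting `u_j` and dilating `v_j` by `η` with `η² = (p + q) /
q`, preserves the total mass of component `j`. The kinetic energy is exactly quadratic, and by
`(H_3)` the part of the potential energy depending on component `j` is at least quadratic. Hence the
average of the two new energies with weights `p / (p + q)` and `q / (p + q)` is at most the old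
energy, and one of the two choices does not increase it. This is done for every index in turn.

Separation (`exists_J_le_add`). Suppose now that `v_j = 0` for some `j`. By `(H_3)`, `F` is periodic
in `x` on the hyperplane `u_j = 0`, so translating `v` by a large multiple of that period keeps its
energy. After truncation to compact support the potential energies add up, because `F(x, 0) = 0`;
the kinetic energies add up index by index because one of the two summands is zero. If no `v_j`
vanishes, then `u = 0` and `v` alone is the competitor.

Strictness. `(H_6)` bounds the potential energy by a combination, with fixed constants, of the
amounts by which dilation beats quadratic growth (`excess`, `H6.exists_pot_le`). The infimum over
`S_a` is negative (`exists_J_neg`), so an almost minimizer has potential energy bounded away from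
zero, and some component has an excess bounded away from zero. Rounding this component first gains a
fixed amount, which beats the approximation errors.

The infima are finite: `α > N/2` gives a sup-norm Gagliardo–Nirenberg bound, and `l_i < 4α/N` makes
the potential energy subcritical (`exists_le_J`). -/

variable {N m : ℕ} {α : ℝ} {F : RN N → (Fin m → ℝ) → ℝ}

/-! ### Linearity of the Fourier side and of `Λ^α`; Plancherel -/

/-- Complex-valued `L²` functions on `ℝ^N`. -/
abbrev CL2 (N : ℕ) := Lp ℂ 2 (volume : Measure (RN N))

theorem complexify_eq (u : L2 N) :
    complexify u = Complex.ofRealCLM.compLpL 2 (volume : Measure (RN N)) u := rfl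

theorem coeFn_complexify (u : L2 N) : complexify u =ᵐ[volume] fun x => ((u x : ℝ) : ℂ) :=
  Complex.ofRealCLM.coeFn_compLp u

theorem complexify_add (u v : L2 N) : complexify (u + v) = complexify u + complexify v := by
  simp [complexify_eq]

theorem complexify_sub (u v : L2 N) : complexify (u - v) = complexify u - complexify v := by
  simp [complexify_eq]

theorem complexify_smul (c : ℝ) (u : L2 N) : complexify (c • u) = (c : ℂ) • complexify u := by
  rw [complexify_eq, map_smul, ← complexify_eq]
  ext1
  filter_upwards [Lp.coeFn_smul c (complexify u), Lp.coeFn_smul (c : ℂ) (complexify u)] with x h1 h2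
  rw [h1, h2]; simp

theorem norm_complexify (u : L2 N) : ‖complexify u‖ = ‖u‖ := by
  rw [Lp.norm_def, Lp.norm_def]
  congr 1
  refine eLpNorm_congr_norm_ae ?_
  filter_upwards [coeFn_complexify u] with x hx
  rw [hx]; simp

/-- The symbol of `Λ^α`. -/
def symb (α : ℝ) (ξ : RN N) : ℝ := (2 * Real.pi * ‖ξ‖) ^ α

theorem symb_nonneg (ξ : RN N) : 0 ≤ symb α ξ := by unfold symb; positivity

theorem measurable_symb : Measurable (symb (N := N) α) := by unfold symb; fun_prop

/-- The Fourier transform of a real-valued `L²` function. -/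
def hat (u : L2 N) : CL2 N := 𝓕 (complexify u)

theorem norm_hat (u : L2 N) : ‖hat u‖ = ‖u‖ := by
  rw [hat, Lp.norm_fourier_eq, norm_complexify]

theorem hat_add (u v : L2 N) : hat (u + v) = hat u + hat v := by
  rw [hat, complexify_add, FourierAdd.fourier_add]; rfl

theorem hat_smul (c : ℝ) (u : L2 N) : hat (c • u) = (c : ℂ) • hat u := by
  rw [hat, complexify_smul, fourier_smul]; rfl

theorem hat_zero : hat (0 : L2 N) = 0 := by
  simpa using hat_smul 0 (0 : L2 N)

theorem memH_iff_symb (hα : 0 ≤ α) (u : L2 N) :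
    MemH α u ↔ MemLp (fun ξ : RN N => ((symb α ξ : ℝ) : ℂ) * hat u ξ) 2 volume :=
  memH_iff hα u

theorem MemH.add (hα : 0 ≤ α) {u v : L2 N} (hu : MemH α u) (hv : MemH α v) : MemH α (u + v) := by
  rw [memH_iff_symb hα] at *
  refine (memLp_congr_ae ?_).1 (hu.add hv)
  rw [hat_add]
  filter_upwards [Lp.coeFn_add (hat u) (hat v)] with x hx
  rw [hx]; simp [mul_add]

theorem MemH.smul (hα : 0 ≤ α) {u : L2 N} (c : ℝ) (hu : MemH α u) : MemH α (c • u) := by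
  rw [memH_iff_symb hα] at *
  refine (memLp_congr_ae ?_).1 (hu.const_mul (c : ℂ))
  rw [hat_smul]
  filter_upwards [Lp.coeFn_smul (c : ℂ) (hat u)] with x hx
  rw [hx]; simp; ring

theorem memH_zero (hα : 0 ≤ α) : MemH α (0 : L2 N) := by
  rw [memH_iff_symb hα, hat_zero]
  refine (memLp_congr_ae ?_).1 (MemLp.zero (ε := ℂ))
  filter_upwards [Lp.coeFn_zero ℂ 2 (volume : Measure (RN N))] with x hx
  rw [hx]; simp

theorem MemH.sub (hα : 0 ≤ α) {u v : L2 N} (hu : MemH α u) (hv : MemH α v) : MemH α (u - v) := by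
  have := hu.add hα (hv.smul hα (-1))
  rwa [neg_one_smul, ← sub_eq_add_neg] at this

theorem fourier_Lam (hα : 0 ≤ α) {u : L2 N} (hu : MemH α u) :
    (𝓕 (Lam α u) : CL2 N) =ᵐ[volume] fun ξ => ((symb α ξ : ℝ) : ℂ) * hat u ξ := by
  have h := (memH_iff hα u).1 hu
  rw [Lam, dif_pos h, fourier_fourierInv_eq]
  exact h.coeFn_toLp

theorem Lam_eq_of_fourier (hα : 0 ≤ α) {u : L2 N} (hu : MemH α u) {g : CL2 N}
    (hg : (𝓕 g : CL2 N) =ᵐ[volume] fun ξ => ((symb α ξ : ℝ) : ℂ) * hat u ξ) : Lam α u = g := by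
  apply (Lp.fourierTransformₗᵢ (RN N) ℂ).injective
  exact Lp.ext ((fourier_Lam hα hu).trans hg.symm)

theorem Lam_add (hα : 0 ≤ α) {u v : L2 N} (hu : MemH α u) (hv : MemH α v) :
    Lam α (u + v) = Lam α u + Lam α v := by
  refine Lam_eq_of_fourier hα (hu.add hα hv) ?_
  rw [FourierAdd.fourier_add, hat_add]
  filter_upwards [fourier_Lam hα hu, fourier_Lam hα hv, Lp.coeFn_add (hat u) (hat v),
    Lp.coeFn_add (𝓕 (Lam α u) : CL2 N) (𝓕 (Lam α v))] with x h1 h2 h3 h4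
  rw [h3, h4, Pi.add_apply, Pi.add_apply, h1, h2, mul_add]

theorem Lam_smul (hα : 0 ≤ α) {u : L2 N} (c : ℝ) (hu : MemH α u) :
    Lam α (c • u) = (c : ℂ) • Lam α u := by
  refine Lam_eq_of_fourier hα (hu.smul hα c) ?_
  rw [fourier_smul, hat_smul]
  filter_upwards [fourier_Lam hα hu, Lp.coeFn_smul (c : ℂ) (hat u),
    Lp.coeFn_smul (c : ℂ) (𝓕 (Lam α u) : CL2 N)] with x h1 h3 h4
  rw [h3, h4, Pi.smul_apply, Pi.smul_apply, h1, smul_eq_mul, smul_eq_mul]; ring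

theorem Lam_sub (hα : 0 ≤ α) {u v : L2 N} (hu : MemH α u) (hv : MemH α v) :
    Lam α (u - v) = Lam α u - Lam α v := by
  have := Lam_add hα hu (hv.smul hα (-1))
  rw [Lam_smul hα _ hv, neg_one_smul, ← sub_eq_add_neg] at this
  rw [this]; simp [sub_eq_add_neg]

theorem Lam_zero (hα : 0 ≤ α) : Lam α (0 : L2 N) = 0 := by
  simpa using Lam_smul hα 0 (memH_zero (N := N) hα)

theorem integral_norm_sq (g : CL2 N) : ∫ x, ‖g x‖ ^ 2 = ‖g‖ ^ 2 := by
  have := inner_self_eq_norm_sq_to_K (𝕜 := ℂ) g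
  rw [L2.inner_def] at this
  have h2 : ∀ x, inner ℂ (g x) (g x) = ((‖g x‖ ^ 2 : ℝ) : ℂ) := fun x => by
    rw [inner_self_eq_norm_sq_to_K]; simp
  simp_rw [h2] at this
  rw [integral_complex_ofReal] at this
  exact Complex.ofReal_injective (this.trans (by simp))

theorem integral_abs_sq (u : L2 N) : ∫ x, |u x| ^ 2 = ‖u‖ ^ 2 := by
  rw [← norm_complexify, ← integral_norm_sq]
  refine integral_congr_ae ?_
  filter_upwards [coeFn_complexify u] with x hx
  rw [hx]; simp

theorem integrable_norm_sq (g : CL2 N) : Integrable (fun x => ‖g x‖ ^ 2) :=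
  (Lp.memLp g).integrable_norm_pow (by norm_num)

theorem integrable_abs_sq (u : L2 N) : Integrable (fun x => |u x| ^ 2) :=
  (Lp.memLp u).integrable_norm_pow (by norm_num)

theorem norm_Lam_sq (hα : 0 ≤ α) {u : L2 N} (hu : MemH α u) :
    ‖Lam α u‖ ^ 2 = ∫ ξ, symb α ξ ^ 2 * ‖hat u ξ‖ ^ 2 := by
  rw [← Lp.norm_fourier_eq (Lam α u), ← integral_norm_sq]
  refine integral_congr_ae ?_
  filter_upwards [fourier_Lam hα hu] with x hx
  rw [hx, norm_mul, mul_pow]; simp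

theorem integrable_symb_sq (hα : 0 ≤ α) {u : L2 N} (hu : MemH α u) :
    Integrable (fun ξ => symb α ξ ^ 2 * ‖hat u ξ‖ ^ 2) := by
  refine (((memH_iff_symb hα u).1 hu).integrable_norm_pow (by norm_num)).congr
    (ae_of_all _ fun x => ?_)
  simp [mul_pow]

theorem J_eq {m : ℕ} (F : RN N → (Fin m → ℝ) → ℝ) (u : Fin m → L2 N) :
    J α F u = 1 / 2 * ∑ i, ‖Lam α (u i)‖ ^ 2 - ∫ x, F x (fun i => u i x) := by
  rw [J, integral_finsetSum _ fun i _ => integrable_norm_sq _]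
  simp_rw [integral_norm_sq]

theorem mem_S_iff {m : ℕ} {c : Fin m → ℝ} {u : Fin m → L2 N} :
    u ∈ S α c ↔ (∀ i, MemH α (u i)) ∧ ∀ i, ‖u i‖ ^ 2 = c i := by
  simp only [S, Set.mem_ofPred_eq, integral_abs_sq]

/-! ### Compactly supported functions in the Schwartz space -/

/-- A smooth cutoff function, equal to `1` on the unit ball. -/
def cutoff (N : ℕ) : ContDiffBump (0 : RN N) := ⟨1, 2, one_pos, one_lt_two⟩

/-- The function vanishes on the unit ball, and outside it a bound by a constant may be weakened by
the factor `‖y‖ ≥ 1`. The linear form yields a factor `ε` after rescaling `y = ε • x`. -/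
theorem exists_norm_iteratedFDeriv_one_sub_cutoff_le (i : ℕ) :
    ∃ C : ℝ, 0 ≤ C ∧ ∀ y : RN N, ‖iteratedFDeriv ℝ i (fun z => 1 - cutoff N z) y‖ ≤ C * ‖y‖ := by
  have hχ : ContDiff ℝ ∞ (cutoff N) := (cutoff N).contDiff
  set χ : 𝓢(RN N, ℝ) := (cutoff N).hasCompactSupport.toSchwartzMap hχ
  refine ⟨1 + SchwartzMap.seminorm ℝ 0 i χ, by positivity, fun y => ?_⟩
  rcases lt_or_ge ‖y‖ 1 with hy | hy
  · have h0 : (fun z => 1 - cutoff N z) =ᶠ[𝓝 y] fun _ => (0 : ℝ) := by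
      filter_upwards [Metric.isOpen_ball.mem_nhds (show y ∈ Metric.ball (0 : RN N) 1 by simpa using hy)]
        with z hz
      rw [(cutoff N).one_of_mem_closedBall (Metric.ball_subset_closedBall hz), sub_self]
    rw [(h0.iteratedFDeriv ℝ i).eq_of_nhds]
    simp only [iteratedFDeriv_fun_zero, Pi.zero_apply, norm_zero]
    positivity
  · have h1 : ‖iteratedFDeriv ℝ i (fun _ : RN N => (1 : ℝ)) y‖ ≤ 1 := by
      rcases eq_or_ne i 0 with rfl | hi
      · simp
      · simp [iteratedFDeriv_const_of_ne hi]
    have h2 : ‖iteratedFDeriv ℝ i (cutoff N) y‖ ≤ SchwartzMap.seminorm ℝ 0 i χ :=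
      SchwartzMap.norm_iteratedFDeriv_le_seminorm ℝ χ i y
    have h3 : iteratedFDeriv ℝ i (fun z => 1 - cutoff N z) y =
        iteratedFDeriv ℝ i (fun _ : RN N => (1 : ℝ)) y - iteratedFDeriv ℝ i (cutoff N) y :=
      iteratedFDeriv_sub_apply contDiffAt_const (hχ.contDiffAt.of_le (mod_cast le_top))
    rw [h3]
    calc _ ≤ 1 + SchwartzMap.seminorm ℝ 0 i χ := (norm_sub_le _ _).trans (add_le_add h1 h2)
      _ ≤ _ := le_mul_of_one_le_right (by positivity) hy

theorem hasCompactSupport_cutoff_comp_smul {ε : ℝ} (hε : ε ≠ 0) :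
    HasCompactSupport (fun x : RN N => cutoff N (ε • x)) :=
  (cutoff N).hasCompactSupport.comp_homeomorph (Homeomorph.smulOfNeZero ε hε)

theorem hasCompactSupport_cutoff_smul {ε : ℝ} (hε : ε ≠ 0) (f : 𝓢(RN N, ℂ)) :
    HasCompactSupport (fun x : RN N => cutoff N (ε • x) • f x) :=
  (hasCompactSupport_cutoff_comp_smul hε).smul_right

theorem contDiff_cutoff_comp_smul (ε : ℝ) : ContDiff ℝ ∞ (fun x : RN N => cutoff N (ε • x)) :=
  (cutoff N).contDiff.comp (contDiff_const_smul ε)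

/-- Truncation of a Schwartz function at the scale `ε⁻¹`. -/
def truncate (f : 𝓢(RN N, ℂ)) (ε : ℝ) (hε : ε ≠ 0) : 𝓢(RN N, ℂ) :=
  (hasCompactSupport_cutoff_smul hε f).toSchwartzMap
    ((contDiff_cutoff_comp_smul ε).smul (f.smooth ⊤))

theorem truncate_apply (f : 𝓢(RN N, ℂ)) (ε : ℝ) (hε : ε ≠ 0) (x : RN N) :
    truncate f ε hε x = cutoff N (ε • x) • f x := rfl

/-- By the Leibniz rule, each derivative of the cutoff error is at most `C * ε * ‖x‖`; the extra
`‖x‖` is absorbed by the seminorm of `f` of weight `k + 1`. -/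
theorem seminorm_truncate_sub_le (f : 𝓢(RN N, ℂ)) (k l : ℕ) :
    ∃ C : ℝ, 0 ≤ C ∧ ∀ ε (hε : 0 < ε), ε ≤ 1 →
      SchwartzMap.seminorm ℝ k l (truncate f ε hε.ne' - f) ≤ C * ε := by
  choose C hC0 hC using exists_norm_iteratedFDeriv_one_sub_cutoff_le (N := N)
  refine ⟨∑ i ∈ Finset.range (l + 1),
    (l.choose i : ℝ) * C i * SchwartzMap.seminorm ℝ (k + 1) (l - i) f,
    Finset.sum_nonneg fun i _ => by have := hC0 i; positivity, fun ε hε hε1 => ?_⟩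
  have hsum : 0 ≤ ∑ i ∈ Finset.range (l + 1),
      (l.choose i : ℝ) * C i * SchwartzMap.seminorm ℝ (k + 1) (l - i) f :=
    Finset.sum_nonneg fun i _ => by have := hC0 i; positivity
  refine SchwartzMap.seminorm_le_bound ℝ k l _ (by positivity) fun x => ?_
  have hg : ContDiff ℝ ∞ (fun x : RN N => 1 - cutoff N x) := contDiff_const.sub (cutoff N).contDiff
  have hg' : ContDiff ℝ ∞ (fun x : RN N => 1 - cutoff N (ε • x)) :=
    contDiff_const.sub (contDiff_cutoff_comp_smul ε)
  have e : ((truncate f ε hε.ne' - f : 𝓢(RN N, ℂ)) : RN N → ℂ) =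
      -fun x => (1 - cutoff N (ε • x)) • f x := by
    ext x
    rw [sub_apply, truncate_apply, Pi.neg_apply, sub_smul, one_smul, neg_sub]
  rw [e, iteratedFDeriv_neg_apply, norm_neg]
  have hd : ∀ i, ‖iteratedFDeriv ℝ i (fun x : RN N => 1 - cutoff N (ε • x)) x‖ ≤ C i * (ε * ‖x‖) := by
    intro i
    have := iteratedFDeriv_comp_const_smul (i := i) ε (hg.of_le (mod_cast le_top))
    rw [this]
    simp only
    rw [norm_smul]
    have h1 : ‖ε ^ i‖ ≤ 1 := by
      rw [norm_pow, Real.norm_of_nonneg hε.le]; exact pow_le_one₀ hε.le hε1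
    calc _ ≤ 1 * (C i * ‖ε • x‖) := mul_le_mul h1 (hC i _) (norm_nonneg _) zero_le_one
      _ = _ := by rw [one_mul, norm_smul, Real.norm_of_nonneg hε.le]
  calc _ ≤ ‖x‖ ^ k * ∑ i ∈ Finset.range (l + 1), (l.choose i : ℝ) *
        ‖iteratedFDeriv ℝ i (fun x : RN N => 1 - cutoff N (ε • x)) x‖ *
        ‖iteratedFDeriv ℝ (l - i) f x‖ := by
        gcongr
        exact norm_iteratedFDeriv_smul_le hg' (f.smooth ⊤) x (mod_cast le_top)
    _ = ∑ i ∈ Finset.range (l + 1), (l.choose i : ℝ) *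
        ‖iteratedFDeriv ℝ i (fun x : RN N => 1 - cutoff N (ε • x)) x‖ *
        (‖x‖ ^ k * ‖iteratedFDeriv ℝ (l - i) f x‖) := by
        rw [Finset.mul_sum]; exact Finset.sum_congr rfl fun i _ => by ring
    _ ≤ ∑ i ∈ Finset.range (l + 1), (l.choose i : ℝ) * (C i * (ε * ‖x‖)) *
        (‖x‖ ^ k * ‖iteratedFDeriv ℝ (l - i) f x‖) := by
        gcongr with i; exact hd i
    _ = ∑ i ∈ Finset.range (l + 1), (l.choose i : ℝ) * C i *
        (‖x‖ ^ (k + 1) * ‖iteratedFDeriv ℝ (l - i) f x‖) * ε :=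
        Finset.sum_congr rfl fun i _ => by ring
    _ ≤ ∑ i ∈ Finset.range (l + 1), (l.choose i : ℝ) * C i *
        SchwartzMap.seminorm ℝ (k + 1) (l - i) f * ε := by
        gcongr with i
        · have := hC0 i; positivity
        · exact SchwartzMap.le_seminorm ℝ _ _ f x
    _ = _ := by rw [Finset.sum_mul]

/-- Compactly supported functions are dense in the Schwartz space. -/
theorem exists_seq_hasCompactSupport_tendsto (f : 𝓢(RN N, ℂ)) :
    ∃ g : ℕ → 𝓢(RN N, ℂ), (∀ n, HasCompactSupport (g n)) ∧ Tendsto g atTop (𝓝 f) := by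
  have hpos : ∀ n : ℕ, 0 < 1 / ((n : ℝ) + 1) := fun n => by positivity
  refine ⟨fun n => truncate f (1 / ((n : ℝ) + 1)) (hpos n).ne',
    fun n => hasCompactSupport_cutoff_smul (hpos n).ne' f, ?_⟩
  rw [(schwartz_withSeminorms ℝ (RN N) ℂ).tendsto_nhds]
  rintro ⟨k, l⟩ δ hδ
  obtain ⟨C, hC0, hC⟩ := seminorm_truncate_sub_le f k l
  have ht : Tendsto (fun n : ℕ => C * (1 / ((n : ℝ) + 1))) atTop (𝓝 (C * 0)) :=
    tendsto_one_div_add_atTop_nhds_zero_nat.const_mul C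
  rw [mul_zero] at ht
  filter_upwards [ht.eventually_lt_const hδ] with n hn
  refine (hC _ (hpos n) ?_).trans_lt hn
  rw [div_le_one (by positivity)]
  linarith [n.cast_nonneg (α := ℝ)]

/-! ### Translation, conjugation and reflection under the Fourier transform -/

theorem cl2_induction {p : CL2 N → Prop} (hp : IsClosed {g | p g})
    (h : ∀ s : 𝓢(RN N, ℂ), p (s.toLp 2)) (g : CL2 N) : p g :=
  (SchwartzMap.denseRange_toLpCLM (p := 2) ENNReal.ofNat_ne_top).induction_on g hp h

/-- The translate `u(· + h)`. -/
def ctrans (h : RN N) (g : CL2 N) : CL2 N :=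
  Lp.compMeasurePreserving (fun x => x + h) (measurePreserving_add_right volume h) g

theorem coeFn_ctrans (h : RN N) (g : CL2 N) : ctrans h g =ᵐ[volume] fun x => g (x + h) :=
  Lp.coeFn_compMeasurePreserving g (measurePreserving_add_right volume h)

theorem continuous_ctrans (h : RN N) : Continuous (ctrans h) :=
  (Lp.isometry_compMeasurePreserving (measurePreserving_add_right volume h)).continuous

/-- Translation multiplies the Fourier transform by a unimodular phase. Only the modulus is needed,
since it determines membership in `H^α` and the kinetic energy. -/
theorem norm_fourier_ctrans (h : RN N) (g : CL2 N) :
    (fun ξ => ‖(𝓕 (ctrans h g) : CL2 N) ξ‖) =ᵐ[volume] fun ξ => ‖(𝓕 g : CL2 N) ξ‖ := by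
  have hL : LipschitzWith 1 (fun z : ℂ => ‖z‖) := lipschitzWith_one_norm
  -- As an identity in `L²` between continuous functions of `g`, the claim is a closed condition and
  -- may be checked on Schwartz functions.
  have key : hL.compLp norm_zero (𝓕 (ctrans h g) : CL2 N) = hL.compLp norm_zero (𝓕 g : CL2 N) := by
    have hc : Continuous (fun f : CL2 N => (𝓕 f : CL2 N)) :=
      (Lp.fourierTransformₗᵢ (RN N) ℂ).continuous
    have hn := hL.continuous_compLp (p := 2) (μ := (volume : Measure (RN N))) norm_zero
    refine cl2_induction (p := fun g => hL.compLp norm_zero (𝓕 (ctrans h g) : CL2 N) =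
      hL.compLp norm_zero (𝓕 g : CL2 N)) ?_ (fun s => ?_) g
    · exact isClosed_eq (hn.comp (hc.comp (continuous_ctrans h))) (hn.comp hc)
    · have e : ctrans h (s.toLp 2) = (s.compSubConstCLM ℂ (-h)).toLp 2 := by
        ext1
        have q := (measurePreserving_add_right (volume : Measure (RN N)) h).quasiMeasurePreserving
        filter_upwards [coeFn_ctrans h (s.toLp 2), q.ae_eq_comp (s.coeFn_toLp 2 volume),
          (s.compSubConstCLM ℂ (-h)).coeFn_toLp 2 volume] with x h1 h2 h3
        rw [h1, h3]
        simpa using h2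
      rw [e, SchwartzMap.toLp_fourier_eq, SchwartzMap.toLp_fourier_eq]
      ext1
      filter_upwards [hL.coeFn_compLp norm_zero ((𝓕 (s.compSubConstCLM ℂ (-h))).toLp 2),
        hL.coeFn_compLp norm_zero ((𝓕 s).toLp 2), (𝓕 s).coeFn_toLp 2 volume,
        (𝓕 (s.compSubConstCLM ℂ (-h))).coeFn_toLp 2 volume] with x h1 h2 h3 h4
      rw [h1, h2, Function.comp_apply, Function.comp_apply, h3, h4]
      have h5 : (s.compSubConstCLM ℂ (-h) : RN N → ℂ) = s ∘ fun v => v + h := by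
        ext x; simp
      have h6 := congrFun (VectorFourier.fourierIntegral_comp_add_right Real.fourierChar
        (volume : Measure (RN N)) (innerₗ (RN N)) s h) x
      rw [SchwartzMap.fourier_coe, SchwartzMap.fourier_coe, h5]
      refine (congrArg norm h6).trans ?_
      rw [Circle.norm_smul]
      rfl
  filter_upwards [hL.coeFn_compLp norm_zero (𝓕 (ctrans h g) : CL2 N),
    hL.coeFn_compLp norm_zero (𝓕 g : CL2 N)] with x h1 h2
  rw [key] at h1
  exact h1.symm.trans h2

/-- The translate `u(· + h)` of a real-valued function. -/
def trans (h : RN N) (u : L2 N) : L2 N :=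
  Lp.compMeasurePreserving (fun x => x + h) (measurePreserving_add_right volume h) u

theorem coeFn_trans (h : RN N) (u : L2 N) : trans h u =ᵐ[volume] fun x => u (x + h) :=
  Lp.coeFn_compMeasurePreserving u (measurePreserving_add_right volume h)

theorem norm_trans (h : RN N) (u : L2 N) : ‖trans h u‖ = ‖u‖ :=
  Lp.norm_compMeasurePreserving u _

theorem complexify_trans (h : RN N) (u : L2 N) :
    complexify (trans h u) = ctrans h (complexify u) := by
  ext1
  have q := (measurePreserving_add_right (volume : Measure (RN N)) h).quasiMeasurePreserving
  filter_upwards [coeFn_complexify (trans h u), coeFn_ctrans h (complexify u), coeFn_trans h u,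
    q.ae_eq_comp (coeFn_complexify u)] with x h1 h2 h3 h4
  rw [h1, h2, h3]
  exact h4.symm

theorem norm_hat_trans (h : RN N) (u : L2 N) :
    ∀ᵐ ξ, ‖hat (trans h u) ξ‖ = ‖hat u ξ‖ := by
  rw [hat, complexify_trans]
  exact norm_fourier_ctrans h _

theorem MemH.trans (hα : 0 ≤ α) {u : L2 N} (hu : MemH α u) (h : RN N) :
    MemH α (FracSystem.trans h u) := by
  rw [memH_iff_symb hα] at *
  refine hu.congr_norm ?_ ?_
  · exact (Complex.measurable_ofReal.comp measurable_symb).aestronglyMeasurable.mul (Lp.memLp _).1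
  · filter_upwards [norm_hat_trans h u] with x hx
    rw [norm_mul, norm_mul, hx]

theorem norm_Lam_trans (hα : 0 ≤ α) {u : L2 N} (hu : MemH α u) (h : RN N) :
    ‖Lam α (trans h u)‖ = ‖Lam α u‖ := by
  rw [← sq_eq_sq₀ (norm_nonneg _) (norm_nonneg _), norm_Lam_sq hα hu, norm_Lam_sq hα (hu.trans hα h)]
  refine integral_congr_ae ?_
  filter_upwards [norm_hat_trans h u] with x hx
  rw [hx]

/-- Complex conjugation on `L²`. -/
def cconj (N : ℕ) : CL2 N →L[ℝ] CL2 N :=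
  (Complex.conjCLE : ℂ →L[ℝ] ℂ).compLpL 2 (volume : Measure (RN N))

theorem coeFn_cconj (g : CL2 N) : cconj N g =ᵐ[volume] fun x => (starRingEnd ℂ) (g x) :=
  (Complex.conjCLE : ℂ →L[ℝ] ℂ).coeFn_compLpL g

/-- Reflection on `L²`. -/
def cneg (g : CL2 N) : CL2 N :=
  Lp.compMeasurePreserving Neg.neg (Measure.measurePreserving_neg volume) g

theorem coeFn_cneg (g : CL2 N) : cneg g =ᵐ[volume] fun x => g (-x) :=
  Lp.coeFn_compMeasurePreserving g (Measure.measurePreserving_neg volume)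

theorem norm_cneg (g : CL2 N) : ‖cneg g‖ = ‖g‖ :=
  Lp.norm_compMeasurePreserving g _

theorem norm_cconj_le (g : CL2 N) : ‖cconj N g‖ ≤ ‖g‖ := by
  refine Lp.norm_le_norm_of_ae_le ?_
  filter_upwards [coeFn_cconj g] with x hx
  rw [hx]; simp

theorem fourier_conj_apply (f : RN N → ℂ) (ξ : RN N) :
    𝓕 (fun x => (starRingEnd ℂ) (f x)) ξ = (starRingEnd ℂ) (𝓕 f (-ξ)) := by
  rw [Real.fourier_eq', Real.fourier_eq', ← integral_conj]
  refine integral_congr_ae (ae_of_all _ fun x => ?_)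
  simp [← Complex.exp_conj, map_ofNat]

/-- Describes on the Fourier side the passage to real parts. Since the weights are even, taking real
parts does not increase weighted norms, so real functions can be approximated by real ones. -/
theorem fourier_cconj (g : CL2 N) : 𝓕 (cconj N g) = cconj N (cneg (𝓕 g)) := by
  have hc : Continuous (fun f : CL2 N => (𝓕 f : CL2 N)) :=
    (Lp.fourierTransformₗᵢ (RN N) ℂ).continuous
  have hn : Continuous (cneg (N := N)) :=
    (Lp.isometry_compMeasurePreserving (Measure.measurePreserving_neg volume)).continuous
  refine cl2_induction (p := fun g => (𝓕 (cconj N g) : CL2 N) = cconj N (cneg (𝓕 g)))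
    (isClosed_eq (hc.comp (cconj N).continuous) ((cconj N).continuous.comp (hn.comp hc)))
    (fun s => ?_) g
  have e : cconj N (s.toLp 2) = (s.postcompCLM (Complex.conjCLE : ℂ →L[ℝ] ℂ)).toLp 2 := by
    ext1
    filter_upwards [coeFn_cconj (s.toLp 2), s.coeFn_toLp 2 volume,
      (s.postcompCLM (Complex.conjCLE : ℂ →L[ℝ] ℂ)).coeFn_toLp 2 volume] with x h1 h2 h3
    rw [h1, h2, h3]; simp
  rw [e, SchwartzMap.toLp_fourier_eq, SchwartzMap.toLp_fourier_eq]
  ext1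
  have q := (Measure.measurePreserving_neg (volume : Measure (RN N))).quasiMeasurePreserving
  filter_upwards [coeFn_cconj (cneg ((𝓕 s).toLp 2)), coeFn_cneg ((𝓕 s).toLp 2),
    q.ae_eq_comp ((𝓕 s).coeFn_toLp 2 volume),
    (𝓕 (s.postcompCLM (Complex.conjCLE : ℂ →L[ℝ] ℂ))).coeFn_toLp 2 volume] with x h1 h2 h3 h4
  rw [h4, h1, h2]
  simp only [Function.comp_apply] at h3
  rw [h3, SchwartzMap.fourier_coe, SchwartzMap.fourier_coe, ← fourier_conj_apply]
  rfl

/-! ### Density of test functions in `H^α` -/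

/-- The symbol of the Bessel potential. -/
def bessel (α : ℝ) (ξ : RN N) : ℝ := (1 + ‖ξ‖ ^ 2) ^ (α / 2)

theorem bessel_pos (ξ : RN N) : 0 < bessel α ξ := by unfold bessel; positivity

theorem one_le_bessel (hα : 0 ≤ α) (ξ : RN N) : 1 ≤ bessel α ξ :=
  Real.one_le_rpow (by nlinarith [sq_nonneg ‖ξ‖]) (by positivity)

theorem symb_le_bessel (hα : 0 ≤ α) (ξ : RN N) :
    symb α ξ ≤ (2 * Real.pi) ^ α * bessel α ξ := by
  rw [symb, Real.mul_rpow (by positivity) (norm_nonneg _)]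
  gcongr
  have : ‖ξ‖ ^ α = (‖ξ‖ ^ 2) ^ (α / 2) := by
    rw [← Real.rpow_natCast, ← Real.rpow_mul (norm_nonneg _)]; congr 1; push_cast; ring
  rw [this, bessel]
  exact Real.rpow_le_rpow (by positivity) (by linarith) (by positivity)

theorem hasTemperateGrowth_bessel (α : ℝ) :
    Function.HasTemperateGrowth (fun ξ : RN N => ((bessel α ξ : ℝ) : ℂ)) := by
  unfold bessel; fun_prop

theorem MemH.exists_bessel {u : L2 N} (hu : MemH α u) :
    ∃ f : CL2 N, (fun ξ => ((bessel α ξ : ℝ) : ℂ) * hat u ξ) =ᵐ[volume] f := by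
  obtain ⟨f, hf⟩ := TemperedDistribution.memSobolev_iff_exists_smulLeftCLM_fourier.1 hu
  rw [Lp.fourier_toTemperedDistribution_eq] at hf
  exact ⟨f, (smulLeft_eq_iff (hasTemperateGrowth_bessel α) _ _).1 hf⟩

/-- The map `f ↦ (1 + |ξ|²)^(α/2) 𝓕 f` from Schwartz functions to `L²`. -/
def besselFourier (N : ℕ) (α : ℝ) : 𝓢(RN N, ℂ) →L[ℂ] CL2 N :=
  (SchwartzMap.toLpCLM ℂ ℂ 2 (volume : Measure (RN N))).comp
    ((SchwartzMap.smulLeftCLM ℂ (fun ξ : RN N => ((bessel α ξ : ℝ) : ℂ))).comp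
      (fourierCLM ℂ 𝓢(RN N, ℂ)))

theorem besselFourier_apply (s : 𝓢(RN N, ℂ)) : besselFourier N α s =
    (SchwartzMap.smulLeftCLM ℂ (fun ξ : RN N => ((bessel α ξ : ℝ) : ℂ)) (𝓕 s)).toLp 2 volume := rfl

theorem coeFn_besselFourier (s : 𝓢(RN N, ℂ)) :
    besselFourier N α s =ᵐ[volume] fun ξ => ((bessel α ξ : ℝ) : ℂ) * 𝓕 s ξ := by
  rw [besselFourier_apply]
  filter_upwards [SchwartzMap.coeFn_toLp (SchwartzMap.smulLeftCLM ℂ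
    (fun ξ : RN N => ((bessel α ξ : ℝ) : ℂ)) (𝓕 s)) 2 volume] with x hx
  rw [hx, SchwartzMap.smulLeftCLM_apply_apply (hasTemperateGrowth_bessel α), smul_eq_mul]

/-- Multiplication by the Bessel symbol is invertible on Schwartz functions, with the symbol of
exponent `-α` as inverse. The range therefore contains all Schwartz functions. -/
theorem denseRange_besselFourier : DenseRange (besselFourier N α) := by
  have h := SchwartzMap.denseRange_toLpCLM (E := RN N) (F := ℂ) (p := 2)
    (μ := volume) ENNReal.ofNat_ne_top
  refine h.mono ?_
  rintro _ ⟨k, rfl⟩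
  refine ⟨𝓕⁻ (SchwartzMap.smulLeftCLM ℂ (fun ξ : RN N => ((bessel (-α) ξ : ℝ) : ℂ)) k), ?_⟩
  rw [besselFourier_apply, fourier_fourierInv_eq, SchwartzMap.smulLeftCLM_smulLeftCLM_apply
    (hasTemperateGrowth_bessel _) (hasTemperateGrowth_bessel _)]
  have : (fun ξ : RN N => ((bessel α ξ : ℝ) : ℂ)) * (fun ξ : RN N => ((bessel (-α) ξ : ℝ) : ℂ)) =
      fun _ => 1 := by
    ext ξ
    rw [Pi.mul_apply, ← Complex.ofReal_mul, bessel, bessel, ← Real.rpow_add (by positivity)]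
    simp [neg_div]
  rw [this, SchwartzMap.smulLeftCLM_const, one_smul]
  rfl

/-- The real part of a complex Schwartz function. -/
def sre (s : 𝓢(RN N, ℂ)) : 𝓢(RN N, ℝ) := s.postcompCLM Complex.reCLM

/-- A real Schwartz function regarded as a complex one. -/
def sofReal (s : 𝓢(RN N, ℝ)) : 𝓢(RN N, ℂ) := s.postcompCLM Complex.ofRealCLM

theorem complexify_toLp (s : 𝓢(RN N, ℝ)) :
    complexify (s.toLp 2 volume) = (sofReal s).toLp 2 volume := by
  ext1
  filter_upwards [coeFn_complexify (s.toLp 2 volume), s.coeFn_toLp 2 volume,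
    (sofReal s).coeFn_toLp 2 volume] with x h1 h2 h3
  rw [h1, h2, h3]; simp [sofReal]

theorem hat_toLp (s : 𝓢(RN N, ℝ)) : hat (s.toLp 2 volume) = (𝓕 (sofReal s)).toLp 2 volume := by
  rw [hat, complexify_toLp, SchwartzMap.toLp_fourier_eq]

theorem memH_toLp (s : 𝓢(RN N, ℝ)) : MemH α (s.toLp 2 volume) := by
  have := SchwartzMap.memSobolev (s := α) (p := 2) (sofReal s)
  rw [MemH, complexify_toLp]
  rw [Lp.toTemperedDistribution_toLp_eq]
  exact this

theorem complexify_sre (s : 𝓢(RN N, ℂ)) :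
    complexify ((sre s).toLp 2 volume) = (2⁻¹ : ℂ) • (s.toLp 2 volume + cconj N (s.toLp 2 volume)) := by
  ext1
  filter_upwards [coeFn_complexify ((sre s).toLp 2 volume), (sre s).coeFn_toLp 2 volume,
    s.coeFn_toLp 2 volume, Lp.coeFn_smul (2⁻¹ : ℂ) (s.toLp 2 volume + cconj N (s.toLp 2 volume)),
    Lp.coeFn_add (s.toLp 2 volume) (cconj N (s.toLp 2 volume)), coeFn_cconj (s.toLp 2 volume)] with x h1 h2 h3 h4 h5 h6
  rw [h1, h2, h4, Pi.smul_apply, h5, Pi.add_apply, h6, h3, Complex.add_conj]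
  simp [sre]

theorem complexify_eq_half (u : L2 N) :
    complexify u = (2⁻¹ : ℂ) • (complexify u + cconj N (complexify u)) := by
  ext1
  filter_upwards [coeFn_complexify u,
    Lp.coeFn_smul (2⁻¹ : ℂ) (complexify u + cconj N (complexify u)),
    Lp.coeFn_add (complexify u) (cconj N (complexify u)), coeFn_cconj (complexify u)]
    with x h1 h4 h5 h6
  rw [h4, Pi.smul_apply, h5, Pi.add_apply, h6, h1]
  simp; ring

theorem hat_sre_sub (s : 𝓢(RN N, ℂ)) (u : L2 N) :
    hat ((sre s).toLp 2 volume - u) = (2⁻¹ : ℂ) •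
      (((𝓕 s).toLp 2 volume - hat u) + cconj N (cneg ((𝓕 s).toLp 2 volume - hat u))) := by
  have : complexify ((sre s).toLp 2 volume - u) = (2⁻¹ : ℂ) •
      ((s.toLp 2 volume - complexify u) + cconj N (s.toLp 2 volume - complexify u)) := by
    rw [complexify_sub, complexify_sre, complexify_eq_half u, ← smul_sub, ← complexify_eq_half u,
      map_sub]
    congr 1
    abel
  have hs : (𝓕 (s.toLp 2 volume - complexify u) : CL2 N) = (𝓕 s).toLp 2 volume - hat u := by
    rw [← SchwartzMap.toLp_fourier_eq]
    exact (Lp.fourierTransformₗᵢ (RN N) ℂ).map_sub _ _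
  rw [hat, this, fourier_smul, FourierAdd.fourier_add, fourier_cconj, hs]

/-- Real, smooth, compactly supported functions are dense in `H^α`. -/
theorem exists_compact_approx (hα : 0 ≤ α) {u : L2 N} (hu : MemH α u) {ε : ℝ} (hε : 0 < ε) :
    ∃ s : 𝓢(RN N, ℝ), HasCompactSupport s ∧ ‖s.toLp 2 volume - u‖ < ε ∧ ‖Lam α (s.toLp 2 volume - u)‖ < ε := by
  obtain ⟨f, hf⟩ := hu.exists_bessel
  set K : ℝ := 1 + (2 * Real.pi) ^ α
  have hK : 0 < K := by positivity
  obtain ⟨s₀, hs₀⟩ : ∃ s₀, besselFourier N α s₀ ∈ Metric.ball f (ε / K) :=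
    denseRange_besselFourier.exists_mem_open Metric.isOpen_ball
      ⟨f, Metric.mem_ball_self (by positivity)⟩
  -- `besselFourier` is continuous for the Schwartz topology, so replacing `s₀` by a compactly
  -- supported function stays inside the open ball.
  obtain ⟨g, hg, hgs⟩ := exists_seq_hasCompactSupport_tendsto s₀
  obtain ⟨n, hn⟩ := (((((besselFourier N α).continuous.tendsto s₀).comp hgs).eventually
    (Metric.isOpen_ball.mem_nhds hs₀))).exists
  set s := g n
  set D : CL2 N := besselFourier N α s - f
  have hD : ‖D‖ < ε / K := by
    simpa [dist_eq_norm] using hn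
  -- The weighted Fourier error left after passing to the real part; it is no larger than `D`.
  set E : CL2 N := (2⁻¹ : ℂ) • (D + cconj N (cneg D))
  have hE : ‖E‖ ≤ ‖D‖ := by
    have h1 : ‖cconj N (cneg D)‖ ≤ ‖D‖ := (norm_cconj_le _).trans (norm_cneg D).le
    calc ‖E‖ = 2⁻¹ * ‖D + cconj N (cneg D)‖ := by rw [norm_smul]; simp
      _ ≤ 2⁻¹ * (‖D‖ + ‖D‖) := by gcongr; exact (norm_add_le _ _).trans (by gcongr)
      _ = ‖D‖ := by ring
  set w : L2 N := (sre s).toLp 2 volume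
  have hEw : E =ᵐ[volume] fun ξ => ((bessel α ξ : ℝ) : ℂ) * hat (w - u) ξ := by
    set d : CL2 N := (𝓕 s).toLp 2 volume - hat u
    have hDd : D =ᵐ[volume] fun ξ => ((bessel α ξ : ℝ) : ℂ) * d ξ := by
      filter_upwards [hf, coeFn_besselFourier (α := α) s, Lp.coeFn_sub (besselFourier N α s) f,
        Lp.coeFn_sub ((𝓕 s).toLp 2 volume) (hat u), (𝓕 s).coeFn_toLp 2 volume] with x h1 h2 h3 h4 h5
      rw [h3, h4, Pi.sub_apply, Pi.sub_apply, h5, ← h1, h2, mul_sub]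
    have q := (Measure.measurePreserving_neg (volume : Measure (RN N))).quasiMeasurePreserving
    rw [hat_sre_sub]
    filter_upwards [hDd, q.ae_eq_comp hDd, coeFn_cneg D, coeFn_cneg d, coeFn_cconj (cneg D),
      coeFn_cconj (cneg d), Lp.coeFn_add D (cconj N (cneg D)), Lp.coeFn_add d (cconj N (cneg d)),
      Lp.coeFn_smul (2⁻¹ : ℂ) (D + cconj N (cneg D)),
      Lp.coeFn_smul (2⁻¹ : ℂ) (d + cconj N (cneg d))] with x h1 h2 h3 h4 h5 h6 h7 h8 h9 h10
    simp only [Function.comp_apply] at h2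
    rw [h9, h10, Pi.smul_apply, Pi.smul_apply, h7, h8, Pi.add_apply, Pi.add_apply, h5, h6, h3, h4,
      h2, h1, map_mul, Complex.conj_ofReal]
    have : bessel α (-x) = bessel α x := by simp [bessel]
    rw [this, smul_eq_mul, smul_eq_mul]; ring
  have hw : MemH α w := memH_toLp _
  have e1 : ‖w - u‖ ≤ ‖E‖ := by
    rw [← norm_hat]
    refine Lp.norm_le_norm_of_ae_le ?_
    filter_upwards [hEw] with x hx
    rw [hx, norm_mul, Complex.norm_real, Real.norm_of_nonneg (bessel_pos x).le]
    exact le_mul_of_one_le_left (norm_nonneg _) (one_le_bessel hα x)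
  have e2 : ‖Lam α (w - u)‖ ≤ (2 * Real.pi) ^ α * ‖E‖ := by
    rw [← Lp.norm_fourier_eq (Lam α (w - u))]
    refine Lp.norm_le_mul_norm_of_ae_le_mul ?_
    filter_upwards [hEw, fourier_Lam hα (hw.sub hα hu)] with x hx hx'
    rw [hx, hx', norm_mul, norm_mul, Complex.norm_real, Complex.norm_real,
      Real.norm_of_nonneg (bessel_pos x).le, Real.norm_of_nonneg (symb_nonneg x), ← mul_assoc]
    gcongr
    exact symb_le_bessel hα x
  have hK' : K * ‖E‖ < ε := by
    rw [← lt_div_iff₀' hK]; exact hE.trans_lt hD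
  have hp : (0 : ℝ) ≤ (2 * Real.pi) ^ α * ‖E‖ := by positivity
  have hK2 : K * ‖E‖ = ‖E‖ + (2 * Real.pi) ^ α * ‖E‖ := by ring
  refine ⟨sre s, ?_, by linarith, by linarith [norm_nonneg E]⟩
  exact (hg n).comp_left (g := Complex.re) Complex.zero_re

theorem tendsto_norm_Lam (hα : 0 ≤ α) {u : L2 N} (hu : MemH α u) {w : ℕ → L2 N}
    (hw : ∀ n, MemH α (w n)) (h : Tendsto (fun n => ‖Lam α (w n - u)‖) atTop (𝓝 0)) :
    Tendsto (fun n => ‖Lam α (w n)‖) atTop (𝓝 ‖Lam α u‖) := by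
  refine tendsto_norm.comp (tendsto_iff_norm_sub_tendsto_zero.2 ?_)
  refine h.congr fun n => ?_
  rw [Lam_sub hα (hw n) hu]

/-- An element of `H^α` is the limit, in `H^α` and almost everywhere, of smooth functions with
compact support. -/
theorem exists_schwartz_seq (hα : 0 ≤ α) {u : L2 N} (hu : MemH α u) :
    ∃ s : ℕ → 𝓢(RN N, ℝ), (∀ n, HasCompactSupport (s n)) ∧
      Tendsto (fun n => (s n).toLp 2 volume) atTop (𝓝 u) ∧
      Tendsto (fun n => ‖Lam α ((s n).toLp 2 volume)‖) atTop (𝓝 ‖Lam α u‖) ∧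
      ∀ᵐ x, Tendsto (fun n => s n x) atTop (𝓝 (u x)) := by
  have hpos : ∀ n : ℕ, 0 < 1 / ((n : ℝ) + 1) := fun n => by positivity
  choose s hs h1 h2 using fun n : ℕ => exists_compact_approx hα hu (hpos n)
  have ht1 : Tendsto (fun n => (s n).toLp 2 volume) atTop (𝓝 u) :=
    tendsto_iff_norm_sub_tendsto_zero.2 (squeeze_zero (fun _ => norm_nonneg _) (fun n => (h1 n).le)
      tendsto_one_div_add_atTop_nhds_zero_nat)
  have ht2 := tendsto_norm_Lam hα hu (fun n => memH_toLp (s n))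
    (squeeze_zero (fun _ => norm_nonneg _) (fun n => (h2 n).le)
      tendsto_one_div_add_atTop_nhds_zero_nat)
  -- A subsequence converges almost everywhere; the norm limits persist along it.
  obtain ⟨φ, hφ, hae⟩ := (tendstoInMeasure_of_tendsto_Lp ht1).exists_seq_tendsto_ae
  refine ⟨s ∘ φ, fun n => hs _, ht1.comp hφ.tendsto_atTop, ht2.comp hφ.tendsto_atTop, ?_⟩
  have hall : ∀ᵐ x, ∀ n, (s n).toLp 2 volume x = s n x :=
    ae_all_iff.2 fun n => (s n).coeFn_toLp 2 volume
  filter_upwards [hae, hall] with x hx hx'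
  exact hx.congr fun n => hx' _

/-! ### The embedding of `H^α` into `L^∞` -/

/-- The decay at infinity is of order `|ξ|^(-2α)`, and `2α > N`. -/
theorem integrable_inv_one_add_symb_sq (hα : (N : ℝ) / 2 < α) :
    Integrable (fun ξ : RN N => (1 + symb α ξ ^ 2)⁻¹) := by
  have hα0 : 0 ≤ α := le_trans (by positivity) hα.le
  have h1 : Integrable (fun ξ : RN N => (2 : ℝ) ^ (2 * α) * (1 + ‖ξ‖) ^ (-(2 * α))) := by
    refine (integrable_one_add_norm ?_).const_mul _
    rw [finrank_euclideanSpace, Fintype.card_fin]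
    linarith
  refine h1.mono' ?_ (ae_of_all _ fun ξ => ?_)
  · exact ((measurable_symb.pow_const 2).const_add 1).inv.aestronglyMeasurable
  · have hs : symb α ξ ^ 2 = (2 * Real.pi * ‖ξ‖) ^ (2 * α) := by
      rw [symb, ← Real.rpow_natCast, ← Real.rpow_mul (by positivity)]; congr 1; push_cast; ring
    have hr : ‖ξ‖ ≤ 2 * Real.pi * ‖ξ‖ :=
      le_mul_of_one_le_left (norm_nonneg _) (by nlinarith [Real.pi_gt_three])
    have hle : (1 + ‖ξ‖) ^ (2 * α) ≤ 2 ^ (2 * α) * (1 + symb α ξ ^ 2) := by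
      rw [hs]
      rcases le_total (2 * Real.pi * ‖ξ‖) 1 with h | h
      · calc (1 + ‖ξ‖) ^ (2 * α) ≤ 2 ^ (2 * α) :=
              Real.rpow_le_rpow (by positivity) (by linarith) (by positivity)
          _ ≤ _ := le_mul_of_one_le_right (by positivity)
              (le_add_of_nonneg_right (by positivity))
      · calc (1 + ‖ξ‖) ^ (2 * α) ≤ (2 * (2 * Real.pi * ‖ξ‖)) ^ (2 * α) :=
              Real.rpow_le_rpow (by positivity) (by linarith) (by positivity)
          _ = 2 ^ (2 * α) * (2 * Real.pi * ‖ξ‖) ^ (2 * α) :=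
              Real.mul_rpow (by positivity) (by positivity)
          _ ≤ _ := by gcongr; linarith
    rw [Real.norm_of_nonneg (by positivity), Real.rpow_neg (by positivity),
      ← div_eq_mul_inv, le_div_iff₀ (by positivity), ← div_eq_inv_mul, div_le_iff₀ (by positivity)]
    exact hle

/-- The constant in the embedding of `H^α` into `L^∞`. -/
def embConst (N : ℕ) (α : ℝ) : ℝ := ∫ ξ : RN N, (1 + symb α ξ ^ 2)⁻¹

theorem embConst_nonneg : 0 ≤ embConst N α :=
  integral_nonneg fun ξ => by positivity

theorem symb_smul {ρ : ℝ} (hρ : 0 ≤ ρ) (ξ : RN N) : symb α (ρ • ξ) = ρ ^ α * symb α ξ := by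
  rw [symb, symb, norm_smul, Real.norm_of_nonneg hρ, ← Real.mul_rpow hρ (by positivity)]
  congr 1; ring

/-- By Fourier inversion `|s x|` is at most the `L¹` norm of the transform, which is split by a
weighted arithmetic–geometric inequality. The frequency scale `ρ` and the balance `t` stay free so
that they can later depend on the kinetic energy. -/
theorem abs_schwartz_le (hα : (N : ℝ) / 2 < α) (s : 𝓢(RN N, ℝ)) {t ρ : ℝ} (ht : 0 < t)
    (hρ : 0 < ρ) (x : RN N) :
    |s x| ≤ (t * (ρ ^ N * embConst N α) +
      (‖s.toLp 2 volume‖ ^ 2 + (ρ⁻¹ ^ α) ^ 2 * ‖Lam α (s.toLp 2 volume)‖ ^ 2) / t) / 2 := by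
  have hα0 : 0 ≤ α := le_trans (by positivity) hα.le
  set g : 𝓢(RN N, ℂ) := 𝓕 (sofReal s)
  have hg : hat (s.toLp 2 volume) =ᵐ[volume] g := by
    rw [hat_toLp]; exact g.coeFn_toLp 2 volume
  have hH : MemH α (s.toLp 2 volume) := memH_toLp s
  have i1 : Integrable (fun ξ => ‖g ξ‖ ^ 2) := by
    refine (integrable_norm_sq (hat (s.toLp 2 volume))).congr ?_
    filter_upwards [hg] with x hx
    rw [hx]
  have e1 : ∫ ξ, ‖g ξ‖ ^ 2 = ‖s.toLp 2 volume‖ ^ 2 := by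
    rw [← norm_hat, ← integral_norm_sq]
    refine integral_congr_ae ?_
    filter_upwards [hg] with x hx
    rw [hx]
  have i2 : Integrable (fun ξ => symb α ξ ^ 2 * ‖g ξ‖ ^ 2) := by
    refine (integrable_symb_sq hα0 hH).congr ?_
    filter_upwards [hg] with x hx
    rw [hx]
  have e2 : ∫ ξ, symb α ξ ^ 2 * ‖g ξ‖ ^ 2 = ‖Lam α (s.toLp 2 volume)‖ ^ 2 := by
    rw [norm_Lam_sq hα0 hH]
    refine integral_congr_ae ?_
    filter_upwards [hg] with x hx
    rw [hx]
  have i3 : Integrable (fun ξ : RN N => (1 + symb α (ρ⁻¹ • ξ) ^ 2)⁻¹) :=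
    (integrable_inv_one_add_symb_sq hα).comp_smul (inv_ne_zero hρ.ne')
  have e3 : ∫ ξ : RN N, (1 + symb α (ρ⁻¹ • ξ) ^ 2)⁻¹ = ρ ^ N * embConst N α := by
    rw [Measure.integral_comp_inv_smul volume (fun ξ : RN N => (1 + symb α ξ ^ 2)⁻¹) ρ,
      finrank_euclideanSpace, Fintype.card_fin, abs_of_nonneg (by positivity)]
    rfl
  have hx : |s x| ≤ ∫ ξ, ‖g ξ‖ := by
    have h1 : (𝓕⁻ g : 𝓢(RN N, ℂ)) x = ((s x : ℝ) : ℂ) := by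
      simp [g, sofReal]
    have h2 : ‖(𝓕⁻ g : 𝓢(RN N, ℂ)) x‖ ≤ ∫ ξ, ‖g ξ‖ := by
      rw [SchwartzMap.fourierInv_coe]
      exact VectorFourier.norm_fourierIntegral_le_integral_norm _ _ _ _ _
    rwa [h1, Complex.norm_real] at h2
  have hpt : ∀ ξ, ‖g ξ‖ ≤ (t * (1 + symb α (ρ⁻¹ • ξ) ^ 2)⁻¹ +
      (‖g ξ‖ ^ 2 + (ρ⁻¹ ^ α) ^ 2 * (symb α ξ ^ 2 * ‖g ξ‖ ^ 2)) / t) / 2 := by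
    intro ξ
    have hs : (ρ⁻¹ ^ α) ^ 2 * (symb α ξ ^ 2 * ‖g ξ‖ ^ 2) = symb α (ρ⁻¹ • ξ) ^ 2 * ‖g ξ‖ ^ 2 := by
      rw [symb_smul (by positivity)]; ring
    rw [hs]
    set w := 1 + symb α (ρ⁻¹ • ξ) ^ 2
    have hw : 0 < w := by positivity
    have : ‖g ξ‖ ^ 2 + symb α (ρ⁻¹ • ξ) ^ 2 * ‖g ξ‖ ^ 2 = w * ‖g ξ‖ ^ 2 := by ring
    rw [this]
    -- This square is the arithmetic–geometric inequality `2 * ‖g ξ‖ ≤ t / w + w * ‖g ξ‖ ^ 2 / t`.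
    have key : 0 ≤ (t - w * ‖g ξ‖) ^ 2 / (t * w) := by positivity
    have : (t - w * ‖g ξ‖) ^ 2 / (t * w) = t * w⁻¹ + w * ‖g ξ‖ ^ 2 / t - 2 * ‖g ξ‖ := by
      field_simp
      ring
    linarith
  have i4 : Integrable (fun ξ =>
      (‖g ξ‖ ^ 2 + (ρ⁻¹ ^ α) ^ 2 * (symb α ξ ^ 2 * ‖g ξ‖ ^ 2)) / t) :=
    (i1.add (i2.const_mul ((ρ⁻¹ ^ α) ^ 2))).div_const t
  refine hx.trans ((integral_mono_of_nonneg (ae_of_all _ fun _ => norm_nonneg _)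
    (((i3.const_mul t).add i4).div_const 2) (ae_of_all _ hpt)).trans (le_of_eq ?_))
  rw [integral_div, integral_add' (i3.const_mul t) i4, integral_const_mul, e3, integral_div,
    integral_add i1 (i2.const_mul ((ρ⁻¹ ^ α) ^ 2)), integral_const_mul, e1, e2]

/-- The embedding of `H^α` into `L^∞`, with free scaling parameters. -/
theorem ae_abs_le (hα : (N : ℝ) / 2 < α) {u : L2 N} (hu : MemH α u) {t ρ : ℝ} (ht : 0 < t)
    (hρ : 0 < ρ) : ∀ᵐ x, |u x| ≤ (t * (ρ ^ N * embConst N α) +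
      (‖u‖ ^ 2 + (ρ⁻¹ ^ α) ^ 2 * ‖Lam α u‖ ^ 2) / t) / 2 := by
  have hα0 : 0 ≤ α := le_trans (by positivity) hα.le
  obtain ⟨s, -, h1, h2, h3⟩ := exists_schwartz_seq hα0 hu
  filter_upwards [h3] with x hx
  refine le_of_tendsto_of_tendsto' hx.abs ?_ fun n => abs_schwartz_le hα (s n) ht hρ x
  exact ((((h1.norm.pow 2).add ((h2.pow 2).const_mul _)).div_const t).const_add _).div_const 2

theorem exists_ae_abs_le (hα : (N : ℝ) / 2 < α) {u : L2 N} (hu : MemH α u) :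
    ∃ M : ℝ, 0 ≤ M ∧ ∀ᵐ x, |u x| ≤ M := by
  refine ⟨_, ?_, ae_abs_le hα hu one_pos one_pos⟩
  have := embConst_nonneg (N := N) (α := α)
  positivity

/-- Approximation of an element of `H^α` by compactly supported functions with the same mass. -/
theorem exists_compact_seq (hα : 0 ≤ α) {u : L2 N} (hu : MemH α u) :
    ∃ w : ℕ → L2 N, (∀ n, MemH α (w n)) ∧ (∀ n, ‖w n‖ = ‖u‖) ∧
      (∀ n, ∃ R : ℝ, ∀ᵐ x, R < ‖x‖ → w n x = 0) ∧
      Tendsto (fun n => ‖Lam α (w n)‖) atTop (𝓝 ‖Lam α u‖) ∧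
      ∀ᵐ x, Tendsto (fun n => w n x) atTop (𝓝 (u x)) := by
  rcases eq_or_ne u 0 with rfl | hu0
  · refine ⟨fun _ => 0, fun _ => memH_zero hα, fun _ => rfl, fun _ => ⟨0, ?_⟩,
      tendsto_const_nhds, ae_of_all _ fun _ => tendsto_const_nhds⟩
    filter_upwards [Lp.coeFn_zero ℝ 2 (volume : Measure (RN N))] with x hx _
    exact hx
  obtain ⟨s, h0, h1, h2, h3⟩ := exists_schwartz_seq hα hu
  have hu0' : 0 < ‖u‖ := norm_pos_iff.2 hu0
  obtain ⟨n₀, hn₀⟩ := eventually_atTop.1 (h1.norm.eventually_const_lt hu0')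
  set v : ℕ → 𝓢(RN N, ℝ) := fun n => s (n + n₀)
  have hv1 : Tendsto (fun n => ‖(v n).toLp 2 volume‖) atTop (𝓝 ‖u‖) :=
    h1.norm.comp (tendsto_add_atTop_nat n₀)
  have hv2 : Tendsto (fun n => ‖Lam α ((v n).toLp 2 volume)‖) atTop (𝓝 ‖Lam α u‖) :=
    h2.comp (tendsto_add_atTop_nat n₀)
  have hpos : ∀ n, 0 < ‖(v n).toLp 2 volume‖ := fun n => hn₀ _ (Nat.le_add_left _ _)
  -- The factor restoring the exact mass; it tends to `1`, so no limit is disturbed.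
  set k : ℕ → ℝ := fun n => ‖u‖ / ‖(v n).toLp 2 volume‖
  have hk : Tendsto k atTop (𝓝 1) := by
    have := (tendsto_const_nhds (x := ‖u‖)).div hv1 hu0'.ne'
    rwa [div_self hu0'.ne'] at this
  have hk0 : ∀ n, 0 < k n := fun n => div_pos hu0' (hpos n)
  have hcoe : ∀ᵐ x, ∀ n, (k n • (v n).toLp 2 volume : L2 N) x = k n * v n x := by
    refine ae_all_iff.2 fun n => ?_
    filter_upwards [Lp.coeFn_smul (k n) ((v n).toLp 2 volume), (v n).coeFn_toLp 2 volume]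
      with x hx hx'
    rw [hx, Pi.smul_apply, hx', smul_eq_mul]
  refine ⟨fun n => k n • (v n).toLp 2 volume, fun n => (memH_toLp _).smul hα _, fun n => ?_,
    fun n => ?_, ?_, ?_⟩
  · rw [norm_smul, Real.norm_of_nonneg (hk0 n).le, div_mul_cancel₀ _ (hpos n).ne']
  · obtain ⟨R, hR⟩ := (h0 (n + n₀)).isCompact.isBounded.subset_closedBall 0
    refine ⟨R, ?_⟩
    filter_upwards [hcoe] with x hx hxR
    have : v n x = 0 := by
      refine image_eq_zero_of_notMem_tsupport fun h => ?_
      have := hR h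
      rw [mem_closedBall_zero_iff] at this
      linarith
    rw [hx, this, mul_zero]
  · have : ∀ n, ‖Lam α (k n • (v n).toLp 2 volume)‖ = k n * ‖Lam α ((v n).toLp 2 volume)‖ := by
      intro n
      rw [Lam_smul hα _ (memH_toLp _), norm_smul, Complex.norm_real, Real.norm_of_nonneg (hk0 n).le]
    simp_rw [this]
    simpa using hk.mul hv2
  · filter_upwards [h3, hcoe] with x hx hx'
    simp_rw [hx']
    simpa using hk.mul (hx.comp (tendsto_add_atTop_nat n₀))

/-! ### The potential energy: growth, integrability, semicontinuity -/

/-- The potential energy. -/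
def pot (F : RN N → (Fin m → ℝ) → ℝ) (u : Fin m → L2 N) : ℝ := ∫ x, F x (fun i => u i x)

theorem J_eq_pot (u : Fin m → L2 N) :
    J α F u = 1 / 2 * ∑ i, ‖Lam α (u i)‖ ^ 2 - pot F u := J_eq F u

/-- Nonnegativity and mass-subcritical growth. -/
def Growth (α : ℝ) (F : RN N → (Fin m → ℝ) → ℝ) : Prop :=
  ∃ A > 0, ∃ l : Fin m → ℝ, (∀ i, 0 < l i ∧ l i < 4 * α / N) ∧
    ∀ x u, 0 ≤ F x u ∧ F x u ≤ A * (∑ i, |u i| ^ 2 + ∑ i, |u i| ^ (l i + 2))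

theorem H1.growth (h : H1 α F) : Growth α F := by
  obtain ⟨-, A, hA, B, -, l, hl, hF⟩ := h
  exact ⟨A, hA, l, hl, fun x u => ⟨(hF x u).1, (hF x u).2.1⟩⟩

/-- The exponent `b i + 2` lies between `2` and `l i + 2`, so its power is dominated by the sum of
the two outer ones. -/
theorem H5.growth (h : H5 α F) : Growth α F := by
  obtain ⟨-, A, hA, B, -, b, l, hl, hF⟩ := h
  refine ⟨2 * A, by positivity, l, fun i => ⟨(hl i).1.trans (hl i).2.1, (hl i).2.2⟩,
    fun x u => ⟨(hF x u).1, (hF x u).2.1.trans ?_⟩⟩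
  rw [mul_comm 2 A, mul_assoc]
  refine mul_le_mul_of_nonneg_left ?_ hA.le
  have hi : ∀ i, |u i| ^ (b i + 2) ≤ |u i| ^ 2 + |u i| ^ (l i + 2) := by
    intro i
    rcases le_total |u i| 1 with h | h
    · have : |u i| ^ (b i + 2) ≤ |u i| ^ (2 : ℝ) :=
        Real.rpow_le_rpow_of_exponent_ge_of_imp (abs_nonneg _) h (by linarith [(hl i).1])
          (fun _ h => absurd h (by linarith [(hl i).1]))
      rw [Real.rpow_two] at this
      exact this.trans (le_add_of_nonneg_right (by positivity))
    · exact (Real.rpow_le_rpow_of_exponent_le h (by linarith [(hl i).2.1])).trans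
        (le_add_of_nonneg_left (by positivity))
  have h2 : 0 ≤ ∑ i, |u i| ^ 2 := Finset.sum_nonneg fun i _ => by positivity
  have := Finset.sum_le_sum fun i (_ : i ∈ Finset.univ) => hi i
  rw [Finset.sum_add_distrib] at this
  linarith

theorem Growth.apply_zero (h : Growth α F) (x : RN N) : F x (fun _ => 0) = 0 := by
  obtain ⟨A, hA, l, hl, hF⟩ := h
  refine le_antisymm ((hF x _).2.trans (le_of_eq ?_)) (hF x _).1
  have : ∀ i, (0 : ℝ) ^ (l i + 2) = 0 := fun i => Real.zero_rpow (by linarith [(hl i).1])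
  simp [this]

theorem Growth.nonneg (h : Growth α F) (x : RN N) (u : Fin m → ℝ) : 0 ≤ F x u := by
  obtain ⟨A, hA, l, hl, hF⟩ := h
  exact (hF x u).1

/-- The first two parts of the `(H_6)` splitting together form the first part of the `(H_3)`
splitting. -/
theorem H6.H3 (h : H6 F) : H3 F := by
  obtain ⟨F1, F2, F3, σ, hσ, hF, h1, h2, h3, h4, h5, -⟩ := h
  intro j
  refine ⟨fun x u => F1 j x u + F2 j x u, F3 j, hF j, fun x u hu => ?_, fun x u θ hθ => ?_, h5 j⟩
  -- At `u j = 0` dilation does nothing, so `2 ^ (2 + σ) * F1 ≤ F1`; with `F1 ≥ 0` this forces `F1 =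
  -- 0`.
  · have e : Function.update u j (2 * u j) = u := by
      rw [hu, mul_zero, ← hu, Function.update_eq_self]
    have := h3 j x u 2 one_le_two
    rw [e] at this
    have h2σ : (1 : ℝ) < 2 ^ (2 + σ) := Real.one_lt_rpow one_lt_two (by linarith)
    have h0 := h1 j x u
    have : F1 j x u = 0 := by nlinarith
    simp only
    rw [this, h2 j x u hu, add_zero]
  · have := h3 j x u θ hθ
    have hle : θ ^ 2 ≤ θ ^ (2 + σ) := by
      rw [← Real.rpow_two]; exact Real.rpow_le_rpow_of_exponent_le hθ (by linarith)
    have := mul_le_mul_of_nonneg_right hle (h1 j x u)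
    have := h4 j x u θ hθ
    simp only
    linarith

/-- For simple `u` the composition is a finite sum of indicators times slices of `F`; continuity in
the second variable passes this to the limit. -/
theorem Caratheodory.aemeasurable_comp (hF : Caratheodory F) {u : RN N → Fin m → ℝ}
    (hu : AEMeasurable u) : AEMeasurable (fun x => F x (u x)) := by
  have hs : StronglyMeasurable (hu.mk u) := hu.measurable_mk.stronglyMeasurable
  have h1 : ∀ n, AEMeasurable (fun x => F x (hs.approx n x)) := by
    intro n
    have : (fun x => F x (hs.approx n x)) = fun x => ∑ y ∈ (hs.approx n).range,
        (hs.approx n ⁻¹' {y}).indicator (fun x => F x y) x := by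
      ext x
      rw [Finset.sum_eq_single (hs.approx n x)]
      · rw [Set.indicator_of_mem (by simp)]
      · intro y _ hy
        rw [Set.indicator_of_notMem]
        simpa using hy.symm
      · intro h
        exact absurd (SimpleFunc.mem_range_self _ x) h
    rw [this]
    exact Finset.aemeasurable_fun_sum _ fun y _ =>
      (hF.1 y).indicator ((hs.approx n).measurableSet_fiber y)
  refine (aemeasurable_of_tendsto_metrizable_ae atTop h1
    (g := fun x => F x (hu.mk u x)) ?_).congr ?_
  · filter_upwards [hF.2] with x hx
    exact (hx.tendsto _).comp (hs.tendsto_approx x)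
  · filter_upwards [hu.ae_eq_mk] with x hx
    rw [hx]

theorem aemeasurable_vec (u : Fin m → L2 N) :
    AEMeasurable (fun x => fun i => u i x) (volume : Measure (RN N)) :=
  aemeasurable_pi_iff.2 fun i => (Lp.memLp (u i)).1.aemeasurable

/-- Elements of `H^α` are bounded, so `|u i| ^ (l i + 2)` is at most a constant times `|u i| ^ 2`.
-/
theorem integrable_comp (hα : (N : ℝ) / 2 < α) (hF : Caratheodory F) (hG : Growth α F)
    {u : Fin m → L2 N} (hu : ∀ i, MemH α (u i)) : Integrable (fun x => F x (fun i => u i x)) := by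
  obtain ⟨A, hA, l, hl, hFA⟩ := hG
  choose M hM0 hM using fun i => exists_ae_abs_le hα (hu i)
  have hi : Integrable (fun x => A * (∑ i, |u i x| ^ 2 + ∑ i, M i ^ l i * |u i x| ^ 2)) :=
    ((integrable_finsetSum _ fun i _ => integrable_abs_sq (u i)).add
      (integrable_finsetSum _ fun i _ => (integrable_abs_sq (u i)).const_mul _)).const_mul A
  refine hi.mono' (hF.aemeasurable_comp (aemeasurable_vec u)).aestronglyMeasurable ?_
  filter_upwards [ae_all_iff.2 hM] with x hx
  rw [Real.norm_of_nonneg (hFA x _).1]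
  refine (hFA x _).2.trans ?_
  gcongr with i
  rw [Real.rpow_add_of_nonneg (abs_nonneg _) (hl i).1.le zero_le_two, Real.rpow_two]
  gcongr
  · exact (hl i).1.le
  · exact hx i

theorem Growth.pot_nonneg (hG : Growth α F) (u : Fin m → L2 N) : 0 ≤ pot F u :=
  integral_nonneg fun x => hG.nonneg x _

/-- Lower semicontinuity from Fatou's lemma, as `F ≥ 0`. It suffices because the potential enters
the energy with a minus sign. -/
theorem eventually_pot_gt (hα : (N : ℝ) / 2 < α) (hF : Caratheodory F) (hG : Growth α F)
    {u : Fin m → L2 N} (hu : ∀ i, MemH α (u i)) {w : ℕ → Fin m → L2 N}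
    (hw : ∀ n i, MemH α (w n i))
    (h : ∀ i, ∀ᵐ x, Tendsto (fun n => w n i x) atTop (𝓝 (u i x))) {ε : ℝ} (hε : 0 < ε) :
    ∀ᶠ n in atTop, pot F u - ε < pot F (w n) := by
  rcases (hG.pot_nonneg u).eq_or_lt with h0 | h0
  · filter_upwards with n
    linarith [hG.pot_nonneg (w n)]
  have hof : ∀ v : Fin m → L2 N, (∀ i, MemH α (v i)) →
      ENNReal.ofReal (pot F v) = ∫⁻ x, ENNReal.ofReal (F x (fun i => v i x)) :=
    fun v hv => ofReal_integral_eq_lintegral_ofReal (integrable_comp hα hF hG hv)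
      (ae_of_all _ fun x => hG.nonneg x _)
  have hle : ∫⁻ x, ENNReal.ofReal (F x (fun i => u i x)) ≤
      liminf (fun n => ∫⁻ x, ENNReal.ofReal (F x (fun i => w n i x))) atTop := by
    refine le_trans (lintegral_mono_ae ?_) (lintegral_liminf_le' fun n =>
      (hF.aemeasurable_comp (aemeasurable_vec (w n))).ennreal_ofReal)
    filter_upwards [hF.2, ae_all_iff.2 h] with x hx hx'
    have : Tendsto (fun n => F x (fun i => w n i x)) atTop (𝓝 (F x (fun i => u i x))) :=
      (hx.tendsto _).comp (tendsto_pi_nhds.2 hx')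
    exact (ENNReal.tendsto_ofReal this).liminf_eq.ge
  rw [← hof u hu] at hle
  have hlt : ENNReal.ofReal (pot F u - ε) < ENNReal.ofReal (pot F u) := by
    rw [ENNReal.ofReal_lt_ofReal_iff h0]; linarith
  filter_upwards [eventually_lt_of_lt_liminf (hlt.trans_le hle)] with n hn'
  rw [← hof _ (hw n)] at hn'
  exact (ENNReal.ofReal_lt_ofReal_iff'.1 hn').1

/-- The energy of an element of `H^α` is almost attained by compactly supported functions with the
same masses. -/
theorem exists_compact_J_le (hα : (N : ℝ) / 2 < α) (hF : Caratheodory F) (hG : Growth α F)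
    {u : Fin m → L2 N} (hu : ∀ i, MemH α (u i)) {ε : ℝ} (hε : 0 < ε) :
    ∃ w : Fin m → L2 N, (∀ i, MemH α (w i)) ∧ (∀ i, ‖w i‖ = ‖u i‖) ∧
      (∃ R : ℝ, ∀ᵐ x, ∀ i, R < ‖x‖ → w i x = 0) ∧ J α F w < J α F u + ε := by
  have hα0 : 0 ≤ α := le_trans (by positivity) hα.le
  choose w h1 h2 h3 h4 h5 using fun i => exists_compact_seq hα0 (hu i)
  have hF' := eventually_pot_gt hα hF hG hu (w := fun n i => w i n) (fun n i => h1 i n) h5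
    (half_pos hε)
  have hK : Tendsto (fun n => 1 / 2 * ∑ i, ‖Lam α (w i n)‖ ^ 2) atTop
      (𝓝 (1 / 2 * ∑ i, ‖Lam α (u i)‖ ^ 2)) :=
    (tendsto_finsetSum _ fun i _ => (h4 i).pow 2).const_mul _
  obtain ⟨n, hn, hn'⟩ := (hF'.and (hK.eventually_lt_const (lt_add_of_pos_right _ (half_pos hε)))).exists
  choose R hR using fun i => h3 i n
  refine ⟨fun i => w i n, fun i => h1 i n, fun i => h2 i n, ⟨∑ i, |R i|, ?_⟩, ?_⟩
  · filter_upwards [ae_all_iff.2 hR] with x hx i hi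
    refine hx i (lt_of_le_of_lt ((le_abs_self _).trans ?_) hi)
    exact Finset.single_le_sum (f := fun i => |R i|) (fun i _ => abs_nonneg _) (Finset.mem_univ i)
  · rw [J_eq_pot, J_eq_pot]
    linarith

/-! ### Separation of two configurations by a large period -/

theorem Periodic.add_nsmul {V : Type*} {G : RN N → V → ℝ} {L : RN N}
    (h : ∀ x v, G (x + L) v = G x v) (n : ℕ) (x : RN N) (v : V) : G (x + n • L) v = G x v := by
  induction n with
  | zero => simp
  | succ k ih => rw [succ_nsmul, ← add_assoc, h, ih]

theorem J_zero (hα : 0 ≤ α) (hG : Growth α F) : J α F (fun _ => (0 : L2 N)) = 0 := by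
  rw [J_eq_pot, Lam_zero hα]
  have : (fun x => F x (fun _ => (0 : L2 N) x)) =ᵐ[volume] fun _ => 0 := by
    filter_upwards [Lp.coeFn_zero ℝ 2 (volume : Measure (RN N))] with x hx
    simp only [hx, Pi.zero_apply]
    exact hG.apply_zero x
  rw [pot, integral_congr_ae this]
  simp

/-- Two configurations with complementary components can be placed far apart without changing the
sum of their energies by more than `ε`. -/
theorem exists_J_le_add (hα : (N : ℝ) / 2 < α) (hF : Caratheodory F) (hG : Growth α F)
    (h3 : H3 F) {u v : Fin m → L2 N} (hu : ∀ i, MemH α (u i)) (hv : ∀ i, MemH α (v i))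
    (huv : ∀ i, u i = 0 ∨ v i = 0) {ε : ℝ} (hε : 0 < ε) :
    ∃ z : Fin m → L2 N, (∀ i, MemH α (z i)) ∧ (∀ i, ‖z i‖ ^ 2 = ‖u i‖ ^ 2 + ‖v i‖ ^ 2) ∧
      J α F z ≤ J α F u + J α F v + ε := by
  have hα0 : 0 ≤ α := le_trans (by positivity) hα.le
  by_cases hj : ∃ j, v j = 0
  swap
  · push Not at hj
    have hu0 : u = fun _ => 0 := funext fun i => (huv i).resolve_right (hj i)
    refine ⟨v, hv, fun i => by simp [hu0], ?_⟩
    rw [hu0, J_zero hα0 hG]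
    linarith
  obtain ⟨j, hj⟩ := hj
  obtain ⟨F1, F2, hF12, hF1, -, L, hL0, hL⟩ := h3 j
  obtain ⟨u', hu', nu', ⟨Ru, hRu⟩, Ju'⟩ := exists_compact_J_le hα hF hG hu (half_pos hε)
  obtain ⟨v', hv', nv', ⟨Rv, hRv⟩, Jv'⟩ := exists_compact_J_le hα hF hG hv (half_pos hε)
  have huv' : ∀ i, u' i = 0 ∨ v' i = 0 := by
    intro i
    refine (huv i).imp (fun h => ?_) (fun h => ?_)
    · rw [← norm_eq_zero, nu', h, norm_zero]
    · rw [← norm_eq_zero, nv', h, norm_zero]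
  have hvj : v' j = 0 := by rw [← norm_eq_zero, nv', hj, norm_zero]
  -- A translation by more than `Ru + Rv` makes the supports disjoint up to null sets.
  obtain ⟨n, hn⟩ := exists_nat_gt ((Ru + Rv) / ‖L‖)
  have hLpos : 0 < ‖L‖ := norm_pos_iff.2 hL0
  rw [div_lt_iff₀ hLpos] at hn
  set h : RN N := n • L
  have hh : Ru + Rv < ‖h‖ := by
    have : ‖h‖ = n * ‖L‖ := by
      rw [show h = (n : ℝ) • L from (Nat.cast_smul_eq_nsmul ℝ n L).symm, norm_smul, Real.norm_natCast]
    rwa [this]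
  set tv : Fin m → L2 N := fun i => trans h (v' i)
  have htv : ∀ i, MemH α (tv i) := fun i => (hv' i).trans hα0 h
  have ht0 : trans h (0 : L2 N) = 0 := by rw [← norm_eq_zero, norm_trans, norm_zero]
  -- Each component of the sum comes from one configuration only, so `Λ^α` produces no cross terms
  -- despite being nonlocal.
  have hz : ∀ i, (u' i + tv i = u' i ∧ v' i = 0) ∨ (u' i + tv i = tv i ∧ u' i = 0) := by
    intro i
    rcases huv' i with h0 | h0
    · right; exact ⟨by rw [h0, zero_add], h0⟩
    · left; exact ⟨by simp only [tv]; rw [h0, ht0, add_zero], h0⟩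
  refine ⟨fun i => u' i + tv i, fun i => (hu' i).add hα0 (htv i), fun i => ?_, ?_⟩
  · rw [← nu' i, ← nv' i]
    simp only
    rcases hz i with ⟨e, e'⟩ | ⟨e, e'⟩
    · rw [e, e']; simp
    · rw [e, e']; simp [tv, norm_trans]
  have hkin : ∀ i, ‖Lam α (u' i + tv i)‖ ^ 2 = ‖Lam α (u' i)‖ ^ 2 + ‖Lam α (v' i)‖ ^ 2 := by
    intro i
    rcases hz i with ⟨e, e'⟩ | ⟨e, e'⟩
    · rw [e, e', Lam_zero hα0]; simp
    · rw [e, e', Lam_zero hα0]; simp [tv, norm_Lam_trans hα0 (hv' i)]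
  -- With `y j = 0` only the periodic part `F2` survives.
  have hper : ∀ (x : RN N) (y : Fin m → ℝ), y j = 0 → F (x + h) y = F x y := by
    intro x y hy
    rw [hF12, hF12, hF1 _ _ hy, hF1 _ _ hy, Periodic.add_nsmul hL]
  have qm := measurePreserving_add_right (volume : Measure (RN N)) h
  have q := qm.quasiMeasurePreserving
  have htvae : ∀ᵐ x, ∀ i, tv i x = v' i (x + h) := ae_all_iff.2 fun i => coeFn_trans h (v' i)
  have hvj' : ∀ᵐ x, v' j x = 0 := by
    rw [hvj]; exact Lp.coeFn_zero ℝ 2 (volume : Measure (RN N))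
  have hFt : pot F tv = pot F v' := by
    rw [pot, pot, ← integral_add_right_eq_self (μ := (volume : Measure (RN N)))
      (fun x => F x (fun i => v' i x)) h]
    refine integral_congr_ae ?_
    filter_upwards [htvae, q.ae hvj'] with x h1 h2
    simp only [h1]
    rw [hper _ _ h2]
  have hFz : pot F (fun i => u' i + tv i) = pot F u' + pot F v' := by
    rw [← hFt, pot, pot, pot, ← integral_add (integrable_comp hα hF hG hu') (integrable_comp hα hF hG htv)]
    refine integral_congr_ae ?_
    filter_upwards [htvae, hRu, q.ae hRv, ae_all_iff.2 fun i => Lp.coeFn_add (u' i) (tv i)]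
      with x h1 h2 h3 h4
    have e : (fun i => (u' i + tv i : L2 N) x) = fun i => u' i x + tv i x :=
      funext fun i => h4 i
    rw [e]
    rcases le_or_gt ‖x‖ Ru with hx | hx
    · have : ∀ i, tv i x = 0 := fun i => by
        rw [h1]
        refine h3 i ?_
        have := norm_sub_le (x + h) x
        rw [add_sub_cancel_left] at this
        linarith
      simp only [this, add_zero, hG.apply_zero]
    · have : ∀ i, u' i x = 0 := fun i => h2 i hx
      simp only [this, zero_add, hG.apply_zero]
  rw [J_eq_pot u', J_eq_pot u] at Ju'
  rw [J_eq_pot v', J_eq_pot v] at Jv'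
  rw [J_eq_pot, J_eq_pot u, J_eq_pot v]
  rw [hFz, Finset.sum_congr rfl fun i _ => hkin i, Finset.sum_add_distrib]
  linarith

/-! ### Rounding one component, and merging -/

theorem memH_update {u : Fin m → L2 N} (hu : ∀ i, MemH α (u i)) (j : Fin m)
    {w : L2 N} (hw : MemH α w) (i : Fin m) : MemH α (Function.update u j w i) := by
  rcases eq_or_ne i j with rfl | h
  · rwa [Function.update_self]
  · rw [Function.update_of_ne h]; exact hu i

/-- The excess over quadratic growth of the potential energy under the dilation of one component. -/
def excess (F : RN N → (Fin m → ℝ) → ℝ) (j : Fin m) (θ : ℝ) (u : Fin m → L2 N) : ℝ :=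
  pot F (Function.update u j (θ • u j)) - pot F (Function.update u j 0) -
    θ ^ 2 * (pot F u - pot F (Function.update u j 0))

theorem sum_norm_Lam_update (u : Fin m → L2 N) (j : Fin m) (w : L2 N) :
    ∑ i, ‖Lam α (Function.update u j w i)‖ ^ 2 =
      ‖Lam α w‖ ^ 2 + ∑ i ∈ Finset.univ \ {j}, ‖Lam α (u i)‖ ^ 2 := by
  rw [← Finset.add_sum_erase _ _ (Finset.mem_univ j), Function.update_self, Finset.erase_eq]
  congr 1
  refine Finset.sum_congr rfl fun i hi => ?_
  rw [Function.update_of_ne]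
  simpa using hi

/-- Subtracting the energy with component `j` deleted removes the kinetic terms of the other
components. What remains of the kinetic energy is exactly quadratic in `θ`, so only the potential
contributes a defect. -/
theorem J_update_smul (hα : 0 ≤ α) {u : Fin m → L2 N} (hu : ∀ i, MemH α (u i)) (j : Fin m)
    (θ : ℝ) : J α F (Function.update u j (θ • u j)) - J α F (Function.update u j 0) =
      θ ^ 2 * (J α F u - J α F (Function.update u j 0)) - excess F j θ u := by
  have h1 := sum_norm_Lam_update (α := α) u j (θ • u j)
  have h2 := sum_norm_Lam_update (α := α) u j 0
  have h3 := sum_norm_Lam_update (α := α) u j (u j)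
  rw [Function.update_eq_self] at h3
  rw [Lam_zero hα, norm_zero] at h2
  rw [Lam_smul hα θ (hu j), norm_smul, Complex.norm_real, mul_pow, Real.norm_eq_abs, sq_abs] at h1
  rw [J_eq_pot, J_eq_pot, J_eq_pot, h1, h2, h3, excess]
  ring

theorem ae_update_smul (u : Fin m → L2 N) (j : Fin m) (θ : ℝ) :
    ∀ᵐ x, (fun i => Function.update u j (θ • u j) i x) =
      Function.update (fun i => u i x) j (θ * u j x) := by
  filter_upwards [Lp.coeFn_smul θ (u j)] with x hx
  ext i
  rcases eq_or_ne i j with rfl | h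
  · rw [Function.update_self, Function.update_self, hx]; rfl
  · rw [Function.update_of_ne h, Function.update_of_ne h]

theorem ae_update_zero (u : Fin m → L2 N) (j : Fin m) :
    ∀ᵐ x, (fun i => Function.update u j 0 i x) = Function.update (fun i => u i x) j 0 := by
  filter_upwards [Lp.coeFn_zero ℝ 2 (volume : Measure (RN N))] with x hx
  ext i
  rcases eq_or_ne i j with rfl | h
  · rw [Function.update_self, Function.update_self, hx]; rfl
  · rw [Function.update_of_ne h, Function.update_of_ne h]

/-- The pointwise version of `excess`. -/
def ptExcess (F : RN N → (Fin m → ℝ) → ℝ) (j : Fin m) (θ : ℝ) (x : RN N) (y : Fin m → ℝ) : ℝ :=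
  F x (Function.update y j (θ * y j)) - F x (Function.update y j 0) -
    θ ^ 2 * (F x y - F x (Function.update y j 0))

theorem H3.ptExcess_nonneg (h3 : H3 F) (j : Fin m) {θ : ℝ} (hθ : 1 ≤ θ) (x : RN N)
    (y : Fin m → ℝ) : 0 ≤ ptExcess F j θ x y := by
  obtain ⟨F1, F2, hF, h0, hs, -⟩ := h3 j
  have e1 : (fun i : {i : Fin m // i ≠ j} => Function.update y j (θ * y j) i) = fun i : {i : Fin m // i ≠ j} => y i :=
    funext fun i => Function.update_of_ne i.2 _ _
  have e2 : (fun i : {i : Fin m // i ≠ j} => Function.update y j 0 i) = fun i : {i : Fin m // i ≠ j} => y i :=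
    funext fun i => Function.update_of_ne i.2 _ _
  have h := hs x y θ hθ
  have h00 : F1 x (Function.update y j 0) = 0 := h0 _ _ (Function.update_self _ _ _)
  rw [ptExcess, hF x (Function.update y j (θ * y j)), hF x (Function.update y j 0), hF x y, e1, e2,
    h00]
  linarith

theorem ptExcess_integral (hα : (N : ℝ) / 2 < α) (hF : Caratheodory F) (hG : Growth α F)
    {u : Fin m → L2 N} (hu : ∀ i, MemH α (u i)) (j : Fin m) (θ : ℝ) :
    Integrable (fun x => ptExcess F j θ x (fun i => u i x)) ∧
      ∫ x, ptExcess F j θ x (fun i => u i x) = excess F j θ u := by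
  have hα0 : 0 ≤ α := le_trans (by positivity) hα.le
  have i1 := integrable_comp hα hF hG (memH_update hu j ((hu j).smul hα0 θ))
  have i2 := integrable_comp hα hF hG (memH_update hu j (memH_zero hα0))
  have i3 := integrable_comp hα hF hG hu
  have e : (fun x => F x (fun i => Function.update u j (θ • u j) i x) -
      F x (fun i => Function.update u j 0 i x) -
      θ ^ 2 * (F x (fun i => u i x) - F x (fun i => Function.update u j 0 i x))) =ᵐ[volume]
      fun x => ptExcess F j θ x (fun i => u i x) := by
    filter_upwards [ae_update_smul u j θ, ae_update_zero u j] with x h1 h2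
    rw [h1, h2, ptExcess]
  refine ⟨((i1.sub i2).sub ((i3.sub i2).const_mul _)).congr e, ?_⟩
  have i12 : Integrable (fun x => F x (fun i => Function.update u j (θ • u j) i x) -
      F x (fun i => Function.update u j 0 i x)) := i1.sub i2
  have i32 : Integrable (fun x => θ ^ 2 * (F x (fun i => u i x) -
      F x (fun i => Function.update u j 0 i x))) := (i3.sub i2).const_mul _
  rw [← integral_congr_ae e, integral_sub i12 i32, integral_const_mul, integral_sub i3 i2,
    integral_sub i1 i2]
  rfl

theorem excess_nonneg (hα : (N : ℝ) / 2 < α) (hF : Caratheodory F) (hG : Growth α F) (h3 : H3 F)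
    {u : Fin m → L2 N} (hu : ∀ i, MemH α (u i)) (j : Fin m) {θ : ℝ} (hθ : 1 ≤ θ) :
    0 ≤ excess F j θ u := by
  rw [← (ptExcess_integral hα hF hG hu j θ).2]
  exact integral_nonneg fun x => h3.ptExcess_nonneg j hθ x _

/-- The two `j`-th components can be replaced by one of them, dilated so as to carry the whole mass,
and by zero, without increasing the sum of the energies. -/
theorem exists_round (hα : (N : ℝ) / 2 < α) (hF : Caratheodory F) (hG : Growth α F) (h3 : H3 F)
    {u v : Fin m → L2 N} (hu : ∀ i, MemH α (u i)) (hv : ∀ i, MemH α (v i)) {j : Fin m}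
    (huj : u j ≠ 0) (hvj : v j ≠ 0) {θ : ℝ}
    (hθ : θ ^ 2 * ‖u j‖ ^ 2 = ‖u j‖ ^ 2 + ‖v j‖ ^ 2) :
    ∃ u' v' : Fin m → L2 N, (∀ i, MemH α (u' i)) ∧ (∀ i, MemH α (v' i)) ∧
      (∀ i, i ≠ j → u' i = u i ∧ v' i = v i) ∧ (u' j = 0 ∨ v' j = 0) ∧
      (∀ i, ‖u' i‖ ^ 2 + ‖v' i‖ ^ 2 = ‖u i‖ ^ 2 + ‖v i‖ ^ 2) ∧
      J α F u' + J α F v' ≤ J α F u + J α F v - excess F j θ u / θ ^ 2 := by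
  have hα0 : 0 ≤ α := le_trans (by positivity) hα.le
  set a := ‖u j‖ ^ 2
  set b := ‖v j‖ ^ 2
  have ha : 0 < a := pow_pos (norm_pos_iff.2 huj) 2
  have hb : 0 < b := pow_pos (norm_pos_iff.2 hvj) 2
  set η := √((a + b) / b)
  have hη : η ^ 2 = (a + b) / b := Real.sq_sqrt (by positivity)
  have hη1 : 1 ≤ η := Real.one_le_sqrt.2 (by rw [le_div_iff₀ hb]; linarith)
  have hθ2 : θ ^ 2 = (a + b) / a := by rw [eq_div_iff ha.ne']; exact hθ
  have hJu := J_update_smul (F := F) hα0 hu j θ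
  have hJv := J_update_smul (F := F) hα0 hv j η
  have hev := excess_nonneg hα hF hG h3 hv j hη1
  set g := excess F j θ u
  set g' := excess F j η v
  set A1 := J α F (Function.update u j (θ • u j))
  set A0 := J α F (Function.update u j 0)
  set B1 := J α F (Function.update v j (η • v j))
  set B0 := J α F (Function.update v j 0)
  -- The weights are `1 / θ ^ 2` and `1 / η ^ 2`. They sum to `1`, and cancel the dilation factors
  -- so that `A0` and `B0` drop out; only the nonnegative excess of `v` is discarded.
  have hsum : a / (a + b) * (A1 + B0) + b / (a + b) * (A0 + B1) ≤ J α F u + J α F v - g / θ ^ 2 := by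
    rw [hθ2] at hJu ⊢
    rw [hη] at hJv
    have e1 : A1 = A0 + (a + b) / a * (J α F u - A0) - g := by linarith
    have e2 : B1 = B0 + (a + b) / b * (J α F v - B0) - g' := by linarith
    have : J α F u + J α F v - g / ((a + b) / a) -
        (a / (a + b) * (A1 + B0) + b / (a + b) * (A0 + B1)) = b / (a + b) * g' := by
      rw [e1, e2]; field_simp; ring
    have h0 : 0 ≤ b / (a + b) * g' := by positivity
    linarith
  have hone : a / (a + b) + b / (a + b) = 1 := by rw [← add_div, div_self (by positivity)]
  have hpa : 0 < a / (a + b) := by positivity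
  have hpb : 0 < b / (a + b) := by positivity
  by_cases hle : A1 + B0 ≤ J α F u + J α F v - g / θ ^ 2
  · refine ⟨Function.update u j (θ • u j), Function.update v j 0,
      memH_update hu j ((hu j).smul hα0 θ), memH_update hv j (memH_zero hα0),
      fun i hi => ⟨Function.update_of_ne hi _ _, Function.update_of_ne hi _ _⟩,
      Or.inr (Function.update_self _ _ _), fun i => ?_, hle⟩
    rcases eq_or_ne i j with rfl | hi
    · rw [Function.update_self, Function.update_self, norm_smul, mul_pow, Real.norm_eq_abs, sq_abs,
        hθ]
      simp [a, b]
    · rw [Function.update_of_ne hi, Function.update_of_ne hi]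
  · have hle' : A0 + B1 ≤ J α F u + J α F v - g / θ ^ 2 := by
      by_contra hcon
      push Not at hle hcon
      have h1 := mul_lt_mul_of_pos_left hle hpa
      have h2 := mul_lt_mul_of_pos_left hcon hpb
      have h4 : a / (a + b) * (J α F u + J α F v - g / θ ^ 2) +
          b / (a + b) * (J α F u + J α F v - g / θ ^ 2) = J α F u + J α F v - g / θ ^ 2 := by
        rw [← add_mul, hone, one_mul]
      linarith
    refine ⟨Function.update u j 0, Function.update v j (η • v j),
      memH_update hu j (memH_zero hα0), memH_update hv j ((hv j).smul hα0 η),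
      fun i hi => ⟨Function.update_of_ne hi _ _, Function.update_of_ne hi _ _⟩,
      Or.inl (Function.update_self _ _ _), fun i => ?_, hle'⟩
    rcases eq_or_ne i j with rfl | hi
    · rw [Function.update_self, Function.update_self, norm_smul, mul_pow, Real.norm_eq_abs, sq_abs,
        hη, div_mul_cancel₀ _ hb.ne']
      simp [a, b]
    · rw [Function.update_of_ne hi, Function.update_of_ne hi]

theorem exists_one_le_sq_mul {a b : ℝ} (ha : 0 < a) (hb : 0 ≤ b) :
    ∃ θ : ℝ, 1 ≤ θ ∧ θ ^ 2 * a = a + b := by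
  refine ⟨√((a + b) / a), Real.one_le_sqrt.2 (by rw [le_div_iff₀ ha]; linarith), ?_⟩
  rw [Real.sq_sqrt (by positivity), div_mul_cancel₀ _ ha.ne']

/-- Rounding at one index leaves the others untouched, so the indices can be treated one after
another. -/
theorem exists_round_finset (hα : (N : ℝ) / 2 < α) (hF : Caratheodory F) (hG : Growth α F)
    (h3 : H3 F) {u v : Fin m → L2 N} (hu : ∀ i, MemH α (u i)) (hv : ∀ i, MemH α (v i))
    (s : Finset (Fin m)) :
    ∃ u' v' : Fin m → L2 N, (∀ i, MemH α (u' i)) ∧ (∀ i, MemH α (v' i)) ∧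
      (∀ i ∈ s, u' i = 0 ∨ v' i = 0) ∧
      (∀ i, ‖u' i‖ ^ 2 + ‖v' i‖ ^ 2 = ‖u i‖ ^ 2 + ‖v i‖ ^ 2) ∧
      J α F u' + J α F v' ≤ J α F u + J α F v := by
  induction s using Finset.induction_on with
  | empty => exact ⟨u, v, hu, hv, by simp, fun _ => rfl, le_rfl⟩
  | insert j s hj ih =>
    obtain ⟨u', v', hu', hv', hz, hn, hJ⟩ := ih
    by_cases h0 : u' j = 0 ∨ v' j = 0
    · refine ⟨u', v', hu', hv', fun i hi => ?_, hn, hJ⟩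
      rcases Finset.mem_insert.1 hi with rfl | hi
      · exact h0
      · exact hz i hi
    · push Not at h0
      obtain ⟨θ, hθ1, hθ⟩ := exists_one_le_sq_mul (pow_pos (norm_pos_iff.2 h0.1) 2)
        (sq_nonneg ‖v' j‖)
      obtain ⟨u₁, v₁, hu₁, hv₁, he, hz₁, hn₁, hJ₁⟩ :=
        exists_round hα hF hG h3 hu' hv' h0.1 h0.2 hθ
      have hex := excess_nonneg hα hF hG h3 hu' j hθ1
      refine ⟨u₁, v₁, hu₁, hv₁, fun i hi => ?_, fun i => (hn₁ i).trans (hn i), ?_⟩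
      · rcases eq_or_ne i j with rfl | hij
        · exact hz₁
        · rw [(he i hij).1, (he i hij).2]
          exact hz i ((Finset.mem_insert.1 hi).resolve_left hij)
      · have : 0 ≤ excess F j θ u' / θ ^ 2 := by positivity
        linarith

/-- Two configurations can be merged into one, adding up the masses of their components, at a cost
of at most `ε`. -/
theorem exists_merge (hα : (N : ℝ) / 2 < α) (hF : Caratheodory F) (hG : Growth α F)
    (h3 : H3 F) {u v : Fin m → L2 N} (hu : ∀ i, MemH α (u i)) (hv : ∀ i, MemH α (v i))
    {ε : ℝ} (hε : 0 < ε) :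
    ∃ z : Fin m → L2 N, (∀ i, MemH α (z i)) ∧ (∀ i, ‖z i‖ ^ 2 = ‖u i‖ ^ 2 + ‖v i‖ ^ 2) ∧
      J α F z ≤ J α F u + J α F v + ε := by
  obtain ⟨u', v', hu', hv', hz, hn, hJ⟩ := exists_round_finset hα hF hG h3 hu hv Finset.univ
  obtain ⟨z, hz1, hz2, hz3⟩ :=
    exists_J_le_add hα hF hG h3 hu' hv' (fun i => hz i (Finset.mem_univ i)) hε
  exact ⟨z, hz1, fun i => (hz2 i).trans (hn i), by linarith⟩

/-- A version of `exists_merge` that retains the gain from the superquadratic growth in one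
component. -/
theorem exists_merge_excess (hα : (N : ℝ) / 2 < α) (hF : Caratheodory F) (hG : Growth α F)
    (h3 : H3 F) {u v : Fin m → L2 N} (hu : ∀ i, MemH α (u i)) (hv : ∀ i, MemH α (v i)) {j : Fin m}
    (huj : u j ≠ 0) (hvj : v j ≠ 0) {θ : ℝ}
    (hθ : θ ^ 2 * ‖u j‖ ^ 2 = ‖u j‖ ^ 2 + ‖v j‖ ^ 2) {ε : ℝ} (hε : 0 < ε) :
    ∃ z : Fin m → L2 N, (∀ i, MemH α (z i)) ∧ (∀ i, ‖z i‖ ^ 2 = ‖u i‖ ^ 2 + ‖v i‖ ^ 2) ∧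
      J α F z ≤ J α F u + J α F v - excess F j θ u / θ ^ 2 + ε := by
  obtain ⟨u', v', hu', hv', -, -, hn, hJ⟩ := exists_round hα hF hG h3 hu hv huj hvj hθ
  obtain ⟨z, hz1, hz2, hz3⟩ := exists_merge hα hF hG h3 hu' hv' hε
  exact ⟨z, hz1, fun i => (hz2 i).trans (hn i), by linarith⟩

/-! ### Boundedness from below at fixed masses -/

/-- Absorbs a sublinear power of the kinetic energy into one half of it, the coefficient available
in the energy. -/
theorem exists_mul_rpow_le_half_add {B γ : ℝ} (hB : 0 < B) (hγ0 : 0 ≤ γ) (hγ : γ < 1) :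
    ∃ D : ℝ, ∀ y : ℝ, 0 < y → B * y ^ γ ≤ y / 2 + D := by
  set M : ℝ := (2 * B) ^ (1 / (1 - γ))
  have hM : 0 < M := by positivity
  have h1γ : 0 < 1 - γ := by linarith
  refine ⟨B * M ^ γ, fun y hy => ?_⟩
  rcases le_total y M with h | h
  · have : B * y ^ γ ≤ B * M ^ γ := by gcongr
    linarith
  · have h1 : 2 * B ≤ y ^ (1 - γ) := by
      calc 2 * B = M ^ (1 - γ) := by
            rw [← Real.rpow_mul (by positivity), one_div_mul_cancel h1γ.ne', Real.rpow_one]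
        _ ≤ _ := Real.rpow_le_rpow hM.le h h1γ.le
    have h2 : y ^ (1 - γ) * y ^ γ = y := by
      rw [← Real.rpow_add hy, sub_add_cancel, Real.rpow_one]
    have h3 : 2 * B * y ^ γ ≤ y ^ (1 - γ) * y ^ γ := by gcongr
    have h4 : 0 ≤ B * M ^ γ := by positivity
    linarith

/-- The Gagliardo–Nirenberg inequality for the sup norm, at fixed mass. -/
theorem ae_abs_le_rpow (hN : 1 ≤ N) (hα : (N : ℝ) / 2 < α) {u : L2 N} (hu : MemH α u) :
    ∀ᵐ x, |u x| ≤ (embConst N α + ‖u‖ ^ 2 + 1) * (1 + ‖Lam α u‖ ^ 2) ^ ((N : ℝ) / (4 * α)) := by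
  have hN' : (1 : ℝ) ≤ N := by exact_mod_cast hN
  have hα0 : 0 < α := by linarith
  set T := ‖Lam α u‖ ^ 2
  have hT : 0 ≤ T := by positivity
  -- This scale makes the kinetic term at most `1`. Then `ρ ^ N = q * q`, and `t = q⁻¹` makes both
  -- terms of the bound of order `q`.
  set ρ : ℝ := (1 + T) ^ (1 / (2 * α))
  have hρ : 0 < ρ := by positivity
  set q : ℝ := (1 + T) ^ ((N : ℝ) / (4 * α))
  have hq : 0 < q := by positivity
  have hqρ : ρ ^ N = q * q := by
    rw [← Real.rpow_natCast, ← Real.rpow_mul (by positivity), ← Real.rpow_add (by positivity)]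
    congr 1; field_simp; ring
  have hρα : (ρ⁻¹ ^ α) ^ 2 * T ≤ 1 := by
    have : (ρ⁻¹ ^ α) ^ 2 = (1 + T)⁻¹ := by
      rw [Real.inv_rpow hρ.le, inv_pow, ← Real.rpow_mul (by positivity), ← Real.rpow_natCast,
        ← Real.rpow_mul (by positivity)]
      congr 1
      rw [show 1 / (2 * α) * α * ((2 : ℕ) : ℝ) = 1 by push_cast; field_simp, Real.rpow_one]
    rw [this, ← div_eq_inv_mul, div_le_one (by positivity)]
    linarith
  filter_upwards [ae_abs_le hα hu (inv_pos.2 hq) hρ] with x hx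
  refine hx.trans ?_
  have hE := embConst_nonneg (N := N) (α := α)
  have e : q⁻¹ * (ρ ^ N * embConst N α) = q * embConst N α := by
    rw [hqρ]; field_simp
  rw [e, div_inv_eq_mul]
  have h1 : (‖u‖ ^ 2 + (ρ⁻¹ ^ α) ^ 2 * T) * q ≤ (‖u‖ ^ 2 + 1) * q := by gcongr
  have h2 : 0 ≤ (embConst N α + ‖u‖ ^ 2 + 1) * q := by positivity
  nlinarith

/-- The energy is bounded below at fixed masses. -/
theorem exists_le_J (hN : 1 ≤ N) (hα : (N : ℝ) / 2 < α) (hF : Caratheodory F) (hG : Growth α F)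
    (c : Fin m → ℝ) (hc : ∀ i, 0 < c i) : ∃ D : ℝ, ∀ u ∈ S (N := N) α c, D ≤ J α F u := by
  have hN' : (1 : ℝ) ≤ N := by exact_mod_cast hN
  have hα0 : 0 < α := by linarith
  obtain ⟨A, hA, l, hl, hFA⟩ := id hG
  have hE := embConst_nonneg (N := N) (α := α)
  set γ : Fin m → ℝ := fun i => N / (4 * α) * l i
  have hγ0 : ∀ i, 0 ≤ γ i := fun i => by have := (hl i).1; positivity
  -- Mass subcriticality: `γ i < 1` is the condition `l i < 4 * α / N`.
  have hγ1 : ∀ i, γ i < 1 := fun i => by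
    have := (hl i).2
    rw [lt_div_iff₀ (by positivity)] at this
    simp only [γ]
    rw [div_mul_eq_mul_div, div_lt_one (by positivity)]
    linarith
  set B : Fin m → ℝ := fun i => A * ((embConst N α + c i + 1) ^ l i * c i)
  have hB : ∀ i, 0 < B i := fun i => by have := hc i; positivity
  choose D hD using fun i => exists_mul_rpow_le_half_add (hB i) (hγ0 i) (hγ1 i)
  refine ⟨-∑ i, (1 / 2 + D i) - A * ∑ i, c i, fun u hu => ?_⟩
  rw [mem_S_iff] at hu
  obtain ⟨hu, hn⟩ := hu
  set T : Fin m → ℝ := fun i => ‖Lam α (u i)‖ ^ 2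
  have hT : ∀ i, 0 ≤ T i := fun i => by positivity
  set M : Fin m → ℝ := fun i => (embConst N α + c i + 1) ^ l i * (1 + T i) ^ γ i
  have hpot : pot F u ≤ A * (∑ i, c i + ∑ i, M i * c i) := by
    have hi : Integrable (fun x => A * (∑ i, |u i x| ^ 2 + ∑ i, M i * |u i x| ^ 2)) :=
      ((integrable_finsetSum _ fun i _ => integrable_abs_sq (u i)).add
        (integrable_finsetSum _ fun i _ => (integrable_abs_sq (u i)).const_mul _)).const_mul A
    have hint : ∫ x, A * (∑ i, |u i x| ^ 2 + ∑ i, M i * |u i x| ^ 2) =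
        A * (∑ i, c i + ∑ i, M i * c i) := by
      rw [integral_const_mul, integral_add
        (integrable_finsetSum _ fun i _ => integrable_abs_sq (u i))
        (integrable_finsetSum _ fun i _ => (integrable_abs_sq (u i)).const_mul _),
        integral_finsetSum _ (fun i _ => integrable_abs_sq (u i)),
        integral_finsetSum _ (fun i _ => (integrable_abs_sq (u i)).const_mul _)]
      simp_rw [integral_const_mul, integral_abs_sq, hn]
    rw [← hint, pot]
    refine integral_mono_ae (integrable_comp hα hF hG hu) hi ?_
    filter_upwards [ae_all_iff.2 fun i => ae_abs_le_rpow hN hα (hu i)] with x hx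
    refine (hFA x _).2.trans ?_
    gcongr with i
    have hli := (hl i).1
    have hci := hc i
    rw [Real.rpow_add_of_nonneg (abs_nonneg _) hli.le zero_le_two, Real.rpow_two]
    gcongr
    have h1 := hx i
    rw [hn i] at h1
    calc |u i x| ^ l i ≤ ((embConst N α + c i + 1) * (1 + T i) ^ ((N : ℝ) / (4 * α))) ^ l i :=
          Real.rpow_le_rpow (abs_nonneg _) h1 hli.le
      _ = M i := by
          have := hT i
          rw [Real.mul_rpow (by positivity) (by positivity), ← Real.rpow_mul (by positivity)]
  have hAM : A * ∑ i, M i * c i ≤ ∑ i, ((1 + T i) / 2 + D i) := by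
    rw [Finset.mul_sum]
    refine Finset.sum_le_sum fun i _ => ?_
    refine le_trans (le_of_eq ?_) (hD i (1 + T i) (by have := hT i; positivity))
    simp only [M, B]; ring
  have hsum : ∑ i, ((1 + T i) / 2 + D i) = 1 / 2 * ∑ i, T i + ∑ i, (1 / 2 + D i) := by
    rw [Finset.mul_sum, ← Finset.sum_add_distrib]
    exact Finset.sum_congr rfl fun i _ => by ring
  rw [J_eq_pot]
  have : 1 / 2 * ∑ i, ‖Lam α (u i)‖ ^ 2 = 1 / 2 * ∑ i, T i := rfl
  rw [mul_add] at hpot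
  linarith

/-! ### Negativity of the infimum by spreading out a bump -/

/-- A smooth bump, equal to `1` on the ball of radius `2`. -/
def bump (N : ℕ) : ContDiffBump (0 : RN N) := ⟨2, 3, two_pos, by norm_num⟩

/-- The dilated bump `x ↦ bump (μ x)`. -/
def dilBump (N : ℕ) (μ : ℝ) (hμ : μ ≠ 0) : 𝓢(RN N, ℝ) :=
  HasCompactSupport.toSchwartzMap (f := fun x : RN N => bump N (μ • x))
    ((bump N).hasCompactSupport.comp_homeomorph (Homeomorph.smulOfNeZero μ hμ))
    ((bump N).contDiff.comp (contDiff_const_smul μ))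

theorem dilBump_apply {μ : ℝ} (hμ : μ ≠ 0) (x : RN N) : dilBump N μ hμ x = bump N (μ • x) := rfl

theorem norm_toLp_sq (s : 𝓢(RN N, ℝ)) : ‖s.toLp 2 volume‖ ^ 2 = ∫ x, |s x| ^ 2 := by
  rw [← integral_abs_sq]
  refine integral_congr_ae ?_
  filter_upwards [s.coeFn_toLp 2 volume] with x hx
  rw [hx]

theorem norm_Lam_toLp_sq (hα : 0 ≤ α) (s : 𝓢(RN N, ℝ)) :
    ‖Lam α (s.toLp 2 volume)‖ ^ 2 = ∫ ξ, symb α ξ ^ 2 * ‖𝓕 (sofReal s) ξ‖ ^ 2 := by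
  rw [norm_Lam_sq hα (memH_toLp s), hat_toLp]
  refine integral_congr_ae ?_
  filter_upwards [(𝓕 (sofReal s)).coeFn_toLp 2 volume] with x hx
  rw [hx]

theorem norm_dilBump_sq {μ : ℝ} (hμ : 0 < μ) :
    ‖(dilBump N μ hμ.ne').toLp 2 volume‖ ^ 2 =
      (μ ^ N)⁻¹ * ‖(dilBump N 1 one_ne_zero).toLp 2 volume‖ ^ 2 := by
  rw [norm_toLp_sq, norm_toLp_sq]
  simp_rw [dilBump_apply, one_smul]
  rw [Measure.integral_comp_smul volume (fun x : RN N => |bump N x| ^ 2) μ,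
    finrank_euclideanSpace, Fintype.card_fin, abs_of_nonneg (by positivity), smul_eq_mul]

theorem fourier_dilBump {μ : ℝ} (hμ : 0 < μ) (ξ : RN N) :
    𝓕 (sofReal (dilBump N μ hμ.ne')) ξ =
      (((μ ^ N)⁻¹ : ℝ) : ℂ) * 𝓕 (sofReal (dilBump N 1 one_ne_zero)) (μ⁻¹ • ξ) := by
  rw [SchwartzMap.fourier_coe, SchwartzMap.fourier_coe, Real.fourier_eq, Real.fourier_eq]
  have h := Measure.integral_comp_smul (volume : Measure (RN N))
    (fun y : RN N => Real.fourierChar (-inner ℝ y (μ⁻¹ • ξ)) •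
      sofReal (dilBump N 1 one_ne_zero) y) μ
  rw [finrank_euclideanSpace, Fintype.card_fin, abs_of_nonneg (by positivity)] at h
  rw [← Complex.real_smul, ← h]
  refine integral_congr_ae (ae_of_all _ fun x => ?_)
  simp only [inner_smul_left, inner_smul_right, sofReal, SchwartzMap.postcompCLM_apply,
    dilBump_apply, one_smul, RCLike.conj_to_real]
  rw [← mul_assoc, inv_mul_cancel₀ hμ.ne', one_mul]

theorem norm_Lam_dilBump_sq (hα : 0 ≤ α) {μ : ℝ} (hμ : 0 < μ) :
    ‖Lam α ((dilBump N μ hμ.ne').toLp 2 volume)‖ ^ 2 =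
      (μ ^ N)⁻¹ * μ ^ (2 * α) * ‖Lam α ((dilBump N 1 one_ne_zero).toLp 2 volume)‖ ^ 2 := by
  rw [norm_Lam_toLp_sq hα, norm_Lam_toLp_sq hα]
  have h := Measure.integral_comp_inv_smul (volume : Measure (RN N))
    (fun ξ : RN N => symb α ξ ^ 2 * ‖𝓕 (sofReal (dilBump N 1 one_ne_zero)) ξ‖ ^ 2) μ
  rw [finrank_euclideanSpace, Fintype.card_fin, abs_of_nonneg (by positivity), smul_eq_mul] at h
  have hμ2 : μ ^ (2 * α) = (μ ^ α) ^ 2 := by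
    rw [← Real.rpow_natCast, ← Real.rpow_mul hμ.le]; congr 1; push_cast; ring
  have e : ∀ ξ : RN N, symb α ξ ^ 2 * ‖𝓕 (sofReal (dilBump N μ hμ.ne')) ξ‖ ^ 2 =
      (((μ ^ N)⁻¹) ^ 2 * μ ^ (2 * α)) * (symb α (μ⁻¹ • ξ) ^ 2 *
        ‖𝓕 (sofReal (dilBump N 1 one_ne_zero)) (μ⁻¹ • ξ)‖ ^ 2) := by
    intro ξ
    have : symb α ξ = μ ^ α * symb α (μ⁻¹ • ξ) := by
      rw [← symb_smul hμ.le, smul_smul, mul_inv_cancel₀ hμ.ne', one_smul]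
    rw [fourier_dilBump hμ, norm_mul, Complex.norm_real, Real.norm_of_nonneg (by positivity), this,
      hμ2]
    ring
  simp_rw [e]
  rw [integral_const_mul, h]
  field_simp

theorem norm_bump_pos (N : ℕ) : 0 < ‖(dilBump N 1 one_ne_zero).toLp 2 volume‖ ^ 2 := by
  rw [norm_toLp_sq]
  have hi : Integrable (fun x => |dilBump N 1 one_ne_zero x| ^ 2) := by
    refine (integrable_abs_sq ((dilBump N 1 one_ne_zero).toLp 2 volume)).congr ?_
    filter_upwards [(dilBump N 1 one_ne_zero).coeFn_toLp 2 volume] with x hx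
    rw [hx]
  refine ((dilBump N 1 one_ne_zero).continuous.abs.pow 2).integral_pos_of_hasCompactSupport_nonneg_nonzero ?_
    (fun x => by positivity) (x := 0) ?_
  · exact (HasCompactSupport.comp_left (g := fun y : ℝ => |y| ^ 2) ((bump N).hasCompactSupport.comp_homeomorph
      (Homeomorph.smulOfNeZero (1 : ℝ) one_ne_zero)) (by simp))
  · simp only [dilBump_apply, smul_zero]
    rw [(bump N).one_of_mem_closedBall (Metric.mem_closedBall_self (by simp [bump]))]
    simp

/-- The constrained infimum is negative. -/
theorem exists_J_neg (hN : 1 ≤ N) (hα : (N : ℝ) / 2 < α) (hF : Caratheodory F) (hG : Growth α F)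
    (h2 : H2 α F) {c : Fin m → ℝ} (hc : ∀ i, 0 < c i) : ∃ u ∈ S (N := N) α c, J α F u < 0 := by
  have hα0 : 0 ≤ α := le_trans (by positivity) hα.le
  obtain ⟨β, hβ, S₀, hS, R, hR, s, t, hs, ht0, -, ht, hlow⟩ := h2
  set b : ℝ := ‖(dilBump N 1 one_ne_zero).toLp 2 volume‖ ^ 2
  have hb : 0 < b := norm_bump_pos N
  set T : ℝ := ‖Lam α ((dilBump N 1 one_ne_zero).toLp 2 volume)‖ ^ 2
  have hT : 0 ≤ T := by positivity
  -- The ball of radius `1 / 2` about `x₀` lies in the annulus `1 ≤ ‖y‖ ≤ 2`. There the bump equals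
  -- `1`, and `x = μ⁻¹ • y` has norm at least `R` once `μ * R < 1`.
  obtain ⟨x₀, hx₀⟩ : ∃ x₀ : RN N, ‖x₀‖ = 3 / 2 := by
    have : Nonempty (Fin N) := ⟨⟨0, hN⟩⟩
    exact exists_norm_eq _ (by norm_num)
  set V : ℝ := (volume : Measure (RN N)).real (Metric.ball x₀ (1 / 2))
  have hV : 0 < V := ENNReal.toReal_pos (Metric.measure_ball_pos _ _ (by norm_num)).ne'
    measure_ball_lt_top.ne
  set P : ℝ := ∏ i, √(c i / b) ^ s i
  have hP : 0 < P := Finset.prod_pos fun i _ =>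
    Real.rpow_pos_of_pos (Real.sqrt_pos.2 (div_pos (hc i) hb)) _
  set C : ℝ := ∑ i, c i / b
  set σ : ℝ := ∑ i, s i
  -- The potential energy is at least a constant times `μ ^ e`, while the kinetic energy scales as
  -- `μ ^ (2 * α)`. The condition on `t` in `(H_2)` says `e < 2 * α`, so the potential wins as `μ →
  -- 0`.
  set e : ℝ := t + N / 2 * σ - N
  have he : 0 < 2 * α - e := by simp only [e]; nlinarith
  set K : ℝ := β * 2 ^ (-t) * P * V
  have hK : 0 < K := by positivity
  obtain ⟨μ, hμR, hμS, hμK, hμ⟩ : ∃ μ : ℝ, μ * R < 1 ∧ μ ^ N * C < S₀ ∧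
      1 / 2 * (C * T) * μ ^ (2 * α - e) < K ∧ 0 < μ := by
    have t1 : Tendsto (fun μ : ℝ => μ * R) (𝓝[>] 0) (𝓝 0) := by
      have : ContinuousAt (fun μ : ℝ => μ * R) 0 := by fun_prop
      simpa using this.tendsto.mono_left nhdsWithin_le_nhds
    have t2 : Tendsto (fun μ : ℝ => μ ^ N * C) (𝓝[>] 0) (𝓝 0) := by
      have : ContinuousAt (fun μ : ℝ => μ ^ N * C) 0 := by fun_prop
      have h0 : N ≠ 0 := by omega
      simpa [h0] using this.tendsto.mono_left nhdsWithin_le_nhds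
    have t3 : Tendsto (fun μ : ℝ => 1 / 2 * (C * T) * μ ^ (2 * α - e)) (𝓝[>] 0) (𝓝 0) := by
      have : ContinuousAt (fun μ : ℝ => μ ^ (2 * α - e)) 0 :=
        Real.continuousAt_rpow_const _ _ (Or.inr he.le)
      have h := (this.tendsto.mono_left (nhdsWithin_le_nhds (s := Set.Ioi 0))).const_mul
        (1 / 2 * (C * T))
      simpa [Real.zero_rpow he.ne'] using h
    obtain ⟨μ, h1, h2, h3, h4⟩ := ((t1.eventually_lt_const one_pos).and
      ((t2.eventually_lt_const hS).and ((t3.eventually_lt_const hK).and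
        self_mem_nhdsWithin))).exists
    exact ⟨μ, h1, h2, h3, h4⟩
  have hμN : 0 < μ ^ N := by positivity
  set w : 𝓢(RN N, ℝ) := dilBump N μ hμ.ne'
  have hw : ‖w.toLp 2 volume‖ ^ 2 = (μ ^ N)⁻¹ * b := norm_dilBump_sq hμ
  have hwL : ‖Lam α (w.toLp 2 volume)‖ ^ 2 = (μ ^ N)⁻¹ * μ ^ (2 * α) * T :=
    norm_Lam_dilBump_sq hα0 hμ
  -- Amplitudes giving the masses `c i`; they tend to `0` with `μ`, as the smallness condition of
  -- `(H_2)` requires.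
  set k : Fin m → ℝ := fun i => √(μ ^ N) * √(c i / b)
  have hk : ∀ i, 0 < k i := fun i =>
    mul_pos (Real.sqrt_pos.2 hμN) (Real.sqrt_pos.2 (div_pos (hc i) hb))
  have hk2 : ∀ i, k i ^ 2 = μ ^ N * (c i / b) := fun i => by
    rw [mul_pow, Real.sq_sqrt hμN.le, Real.sq_sqrt (div_pos (hc i) hb).le]
  set u : Fin m → L2 N := fun i => k i • w.toLp 2 volume
  have hwH : MemH α (w.toLp 2 volume) := memH_toLp w
  have hu : ∀ i, MemH α (u i) := fun i => hwH.smul hα0 _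
  have huS : u ∈ S α c := by
    rw [mem_S_iff]
    refine ⟨hu, fun i => ?_⟩
    rw [norm_smul, mul_pow, hw, Real.norm_eq_abs, sq_abs, hk2]
    field_simp
  refine ⟨u, huS, ?_⟩
  have hkin : ∑ i, ‖Lam α (u i)‖ ^ 2 = C * T * μ ^ (2 * α) := by
    have : ∀ i, ‖Lam α (u i)‖ ^ 2 = c i / b * (T * μ ^ (2 * α)) := by
      intro i
      rw [Lam_smul hα0 _ hwH, norm_smul, mul_pow, hwL, Complex.norm_real, Real.norm_eq_abs, sq_abs,
        hk2]
      field_simp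
    simp_rw [this]
    rw [← Finset.sum_mul]; ring
  set Q : Set (RN N) := (fun x => μ • x) ⁻¹' Metric.ball x₀ (1 / 2)
  have hQm : MeasurableSet Q := (measurable_const_smul μ) measurableSet_ball
  have hQv : (volume : Measure (RN N)).real Q = (μ ^ N)⁻¹ * V := by
    rw [Measure.real, Measure.addHaar_preimage_smul volume hμ.ne', finrank_euclideanSpace,
      Fintype.card_fin, ENNReal.toReal_mul, ENNReal.toReal_ofReal (abs_nonneg _),
      abs_of_nonneg (by positivity)]
    rfl
  have hQ : ∀ x ∈ Q, 1 ≤ μ * ‖x‖ ∧ μ * ‖x‖ ≤ 2 := by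
    intro x hx
    have hd : ‖μ • x - x₀‖ < 1 / 2 := by
      have : μ • x ∈ Metric.ball x₀ (1 / 2) := hx
      rwa [mem_ball_iff_norm] at this
    have e1 : ‖μ • x‖ = μ * ‖x‖ := by rw [norm_smul, Real.norm_of_nonneg hμ.le]
    have h1 := norm_sub_norm_le (μ • x) x₀
    have h2 := norm_sub_norm_le x₀ (μ • x)
    rw [norm_sub_rev] at h2
    rw [e1, hx₀] at h1 h2
    constructor <;> linarith
  have hcoe : ∀ᵐ x, ∀ i, u i x = k i * w x := by
    refine ae_all_iff.2 fun i => ?_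
    filter_upwards [Lp.coeFn_smul (k i) (w.toLp 2 volume), w.coeFn_toLp 2 volume] with x h1 h2
    rw [h1, Pi.smul_apply, h2, smul_eq_mul]
  have hprod : ∏ i, |k i| ^ s i = μ ^ ((N : ℝ) / 2 * σ) * P := by
    have : ∀ i, |k i| ^ s i = (μ ^ ((N : ℝ) / 2)) ^ s i * √(c i / b) ^ s i := by
      intro i
      rw [abs_of_pos (hk i), Real.mul_rpow (by positivity) (by positivity)]
      congr 2
      rw [Real.sqrt_eq_rpow, ← Real.rpow_natCast, ← Real.rpow_mul hμ.le]
      congr 1; ring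
    simp_rw [this]
    rw [Finset.prod_mul_distrib, ← Real.rpow_sum_of_pos (by positivity), ← Real.rpow_mul hμ.le]
  set B : ℝ := β * (2 / μ) ^ (-t) * ∏ i, |k i| ^ s i
  have hpt : ∀ᵐ x, x ∈ Q → B ≤ F x (fun i => u i x) := by
    filter_upwards [hcoe] with x hx hxQ
    obtain ⟨hx1, hx2⟩ := hQ x hxQ
    have hw1 : w x = 1 := by
      rw [show w x = bump N (μ • x) from rfl, (bump N).one_of_mem_closedBall]
      rw [mem_closedBall_zero_iff, norm_smul, Real.norm_of_nonneg hμ.le]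
      exact hx2
    have hux : (fun i => u i x) = k := funext fun i => by rw [hx i, hw1, mul_one]
    have hxpos : 0 < ‖x‖ := by
      by_contra h
      have : ‖x‖ = 0 := le_antisymm (not_lt.1 h) (norm_nonneg _)
      rw [this] at hx1; linarith
    rw [hux]
    refine le_trans ?_ (hlow x k ?_ ?_ fun i => (hk i).ne').le
    · have : ‖x‖ ≤ 2 / μ := by rw [le_div_iff₀ hμ]; linarith
      have h3 : (2 / μ) ^ (-t) ≤ ‖x‖ ^ (-t) :=
        Real.rpow_le_rpow_of_nonpos hxpos this (by linarith)
      have h4 : 0 ≤ ∏ i, |k i| ^ s i := Finset.prod_nonneg fun i _ => by positivity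
      simp only [B]
      gcongr
    · have : μ * R ≤ μ * ‖x‖ := by linarith
      exact le_of_mul_le_mul_left this hμ
    · simp_rw [sq_abs, hk2]
      rwa [← Finset.mul_sum]
  have hFi := integrable_comp hα hF hG hu
  have hpot : B * ((μ ^ N)⁻¹ * V) ≤ pot F u := by
    have h1 : ∫ x in Q, F x (fun i => u i x) ≤ pot F u :=
      setIntegral_le_integral hFi (ae_of_all _ fun x => hG.nonneg x _)
    have hQfin : volume Q ≠ ⊤ := by
      rw [Measure.addHaar_preimage_smul volume hμ.ne']
      exact ENNReal.mul_ne_top ENNReal.ofReal_ne_top measure_ball_lt_top.ne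
    have h2 : ∫ x in Q, B ≤ ∫ x in Q, F x (fun i => u i x) :=
      setIntegral_mono_on_ae (integrableOn_const hQfin) hFi.integrableOn hQm hpt
    rw [setIntegral_const, hQv, smul_eq_mul] at h2
    linarith
  have hB : B * ((μ ^ N)⁻¹ * V) = K * μ ^ e := by
    have e1 : (2 / μ) ^ (-t) = 2 ^ (-t) * μ ^ t := by
      rw [Real.div_rpow two_pos.le hμ.le, Real.rpow_neg hμ.le t, div_inv_eq_mul]
    have e2 : μ ^ e = μ ^ t * μ ^ ((N : ℝ) / 2 * σ) * (μ ^ N)⁻¹ := by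
      simp only [e]
      rw [Real.rpow_sub hμ, Real.rpow_add hμ, Real.rpow_natCast, div_eq_mul_inv]
    simp only [B, K]
    rw [hprod, e1, e2]; ring
  rw [J_eq_pot, hkin]
  have hfin : 1 / 2 * (C * T * μ ^ (2 * α)) < K * μ ^ e := by
    have : μ ^ (2 * α) = μ ^ (2 * α - e) * μ ^ e := by
      rw [← Real.rpow_add hμ, sub_add_cancel]
    rw [this]
    have := mul_lt_mul_of_pos_right hμK (Real.rpow_pos_of_pos hμ e)
    linarith
  linarith

/-! ### Finiteness of the infima and the two inequalities -/

/-- The constrained infimum is a real number. -/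
theorem exists_I_eq (hN : 1 ≤ N) (hα : (N : ℝ) / 2 < α) (hF : Caratheodory F) (hG : Growth α F)
    (h2 : H2 α F) {c : Fin m → ℝ} (hc : ∀ i, 0 < c i) :
    ∃ r : ℝ, I α F c = r ∧ r < 0 ∧ (∀ u ∈ S (N := N) α c, r ≤ J α F u) ∧
      ∀ ε > 0, ∃ u ∈ S (N := N) α c, J α F u < r + ε := by
  obtain ⟨D, hD⟩ := exists_le_J hN hα hF hG c hc
  obtain ⟨u₀, hu₀, hJ₀⟩ := exists_J_neg hN hα hF hG h2 hc
  have hbdd : BddBelow (J α F '' S α c) := ⟨D, by rintro _ ⟨u, hu, rfl⟩; exact hD u hu⟩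
  have hle : ∀ u ∈ S (N := N) α c, sInf (J α F '' S α c) ≤ J α F u := fun u hu =>
    csInf_le hbdd ⟨u, hu, rfl⟩
  have hex : ∀ ε > 0, ∃ u ∈ S (N := N) α c, J α F u < sInf (J α F '' S α c) + ε := by
    intro ε hε
    obtain ⟨_, ⟨u, hu, rfl⟩, h⟩ := exists_lt_of_csInf_lt (s := J α F '' S α c) ⟨_, u₀, hu₀, rfl⟩
      (lt_add_of_pos_right _ hε)
    exact ⟨u, hu, h⟩
  refine ⟨sInf (J α F '' S α c), le_antisymm ?_ ?_, (hle u₀ hu₀).trans_lt hJ₀, hle, hex⟩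
  · by_contra h
    obtain ⟨q, hq1, hq2⟩ := EReal.lt_iff_exists_real_btwn.1 (not_le.1 h)
    obtain ⟨u, hu, hJu⟩ := hex (q - sInf (J α F '' S α c)) (sub_pos.2 (EReal.coe_lt_coe_iff.1 hq1))
    have h1 : I α F c ≤ J α F u := iInf₂_le u hu
    have h3 : (q : EReal) < J α F u := hq2.trans_le h1
    rw [EReal.coe_lt_coe_iff] at h3
    linarith
  · exact le_iInf₂ fun u hu => EReal.coe_le_coe_iff.2 (hle u hu)

theorem norm_sq_add_eq {a c : Fin m → ℝ} {u v : Fin m → L2 N} (hu : u ∈ S α a)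
    (hv : v ∈ S α (c - a)) (i : Fin m) : ‖u i‖ ^ 2 + ‖v i‖ ^ 2 = c i := by
  rw [(mem_S_iff.1 hu).2, (mem_S_iff.1 hv).2, Pi.sub_apply, add_sub_cancel]

theorem I_le_add (hN : 1 ≤ N) (hα : (N : ℝ) / 2 < α) (hF : Caratheodory F) (hG : Growth α F)
    (h2 : H2 α F) (h3 : H3 F) {a c : Fin m → ℝ} (hac : ∀ i, 0 < a i ∧ a i < c i) :
    I α F c ≤ I α F a + I α F (c - a) := by
  obtain ⟨rc, ec, -, hc, -⟩ := exists_I_eq hN hα hF hG h2 fun i => (hac i).1.trans (hac i).2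
  obtain ⟨ra, ea, -, -, ha⟩ := exists_I_eq hN hα hF hG h2 fun i => (hac i).1
  obtain ⟨rb, eb, -, -, hb⟩ := exists_I_eq hN hα hF hG h2 (c := c - a)
    fun i => sub_pos.2 (hac i).2
  rw [ec, ea, eb, ← EReal.coe_add, EReal.coe_le_coe_iff]
  refine le_of_forall_pos_le_add fun ε hε => ?_
  obtain ⟨u, hu, hJu⟩ := ha (ε / 3) (by positivity)
  obtain ⟨v, hv, hJv⟩ := hb (ε / 3) (by positivity)
  obtain ⟨z, hz, hzn, hJz⟩ := exists_merge hα hF hG h3 (mem_S_iff.1 hu).1 (mem_S_iff.1 hv).1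
    (show 0 < ε / 3 by positivity)
  have := hc z (mem_S_iff.2 ⟨hz, fun i => (hzn i).trans (norm_sq_add_eq hu hv i)⟩)
  linarith

/-- Under `(H_6)`, the potential energy is controlled by the excesses over quadratic growth. -/
theorem H6.exists_pot_le (h6 : H6 F) (hα : (N : ℝ) / 2 < α) (hF : Caratheodory F)
    (hG : Growth α F) {θ : Fin m → ℝ} (hθ : ∀ j, 1 < θ j) :
    ∃ K : Fin m → ℝ, (∀ j, 0 ≤ K j) ∧ ∀ u : Fin m → L2 N, (∀ i, MemH α (u i)) →
      pot F u ≤ ∑ j, K j * (excess F j (θ j) u / θ j ^ 2) := by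
  obtain ⟨F1, F2, F3, σ, hσ, hsum, h1, h2, hs1, hs2, -, C, hC, hFC⟩ := h6
  set G : Fin m → ℝ := fun j => θ j ^ (2 + σ) - θ j ^ 2
  have hG0 : ∀ j, 0 < G j := fun j => by
    have : θ j ^ (2 : ℝ) < θ j ^ (2 + σ) := Real.rpow_lt_rpow_of_exponent_lt (hθ j) (by linarith)
    rw [Real.rpow_two] at this
    simp only [G]; linarith
  have hθ0 : ∀ j, 0 < θ j := fun j => one_pos.trans (hθ j)
  -- `F3` cancels, `F2` contributes a nonnegative amount, and the value of `F1` at `y j = 0` enters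
  -- with the nonnegative factor `θ j ^ 2 - 1`.
  have hpt : ∀ j x y, G j * F1 j x y ≤ ptExcess F j (θ j) x y := by
    intro j x y
    have e1 : (fun i : {i : Fin m // i ≠ j} => Function.update y j (θ j * y j) i) =
        fun i : {i : Fin m // i ≠ j} => y i := funext fun i => Function.update_of_ne i.2 _ _
    have e2 : (fun i : {i : Fin m // i ≠ j} => Function.update y j 0 i) =
        fun i : {i : Fin m // i ≠ j} => y i := funext fun i => Function.update_of_ne i.2 _ _
    have hz2 : F2 j x (Function.update y j 0) = 0 := h2 _ _ _ (Function.update_self _ _ _)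
    have hz1 := h1 j x (Function.update y j 0)
    have hθ2 : 0 ≤ θ j ^ 2 - 1 := by have := one_le_pow₀ (n := 2) (hθ j).le; linarith
    have hm := mul_nonneg hθ2 hz1
    have ha := hs1 j x y (θ j) (hθ j).le
    have hb := hs2 j x y (θ j) (hθ j).le
    rw [ptExcess, hsum j x (Function.update y j (θ j * y j)), hsum j x (Function.update y j 0),
      hsum j x y, e1, e2, hz2]
    simp only [G]
    linarith
  refine ⟨fun j => C * θ j ^ 2 / G j, fun j => by have := hG0 j; positivity, fun u hu => ?_⟩
  have hi := fun j => ptExcess_integral hα hF hG hu j (θ j)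
  have hint : Integrable (fun x => ∑ j, C / G j * ptExcess F j (θ j) x (fun i => u i x)) :=
    integrable_finsetSum _ fun j _ => (hi j).1.const_mul _
  have heq : ∑ j, C * θ j ^ 2 / G j * (excess F j (θ j) u / θ j ^ 2) =
      ∫ x, ∑ j, C / G j * ptExcess F j (θ j) x (fun i => u i x) := by
    rw [integral_finsetSum _ fun j _ => (hi j).1.const_mul _]
    refine Finset.sum_congr rfl fun j _ => ?_
    rw [integral_const_mul, (hi j).2]
    have := (hθ0 j).ne'
    field_simp
  rw [heq]
  refine integral_mono (integrable_comp hα hF hG hu) hint fun x => ?_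
  refine (hFC x _).trans ?_
  rw [Finset.mul_sum]
  refine Finset.sum_le_sum fun j _ => ?_
  have hle := hpt j x (fun i => u i x)
  rw [div_mul_eq_mul_div, le_div_iff₀ (hG0 j), mul_assoc, mul_comm (F1 j x _)]
  gcongr

theorem I_lt_add (hN : 1 ≤ N) (hα : (N : ℝ) / 2 < α) (hF : Caratheodory F) (hG : Growth α F)
    (h2 : H2 α F) (h6 : H6 F) {a c : Fin m → ℝ} (hac : ∀ i, 0 < a i ∧ a i < c i) :
    I α F c < I α F a + I α F (c - a) := by
  obtain ⟨rc, ec, -, hc, -⟩ := exists_I_eq hN hα hF hG h2 fun i => (hac i).1.trans (hac i).2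
  obtain ⟨ra, ea, hra, -, ha⟩ := exists_I_eq hN hα hF hG h2 fun i => (hac i).1
  obtain ⟨rb, eb, -, -, hb⟩ := exists_I_eq hN hα hF hG h2 (c := c - a)
    fun i => sub_pos.2 (hac i).2
  rw [ec, ea, eb, ← EReal.coe_add, EReal.coe_lt_coe_iff]
  -- The dilations depend on `a` and `c` only, so the constants `K` are fixed before `u` and `v` are
  -- chosen.
  set θ : Fin m → ℝ := fun i => √(c i / a i)
  have hθ1 : ∀ i, 1 < θ i := fun i => Real.lt_sqrt_of_sq_lt (by
    rw [one_pow, lt_div_iff₀ (hac i).1, one_mul]; exact (hac i).2)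
  have hθ2 : ∀ i, θ i ^ 2 * a i = c i := fun i => by
    rw [Real.sq_sqrt (div_pos ((hac i).1.trans (hac i).2) (hac i).1).le,
      div_mul_cancel₀ _ (hac i).1.ne']
  obtain ⟨K, hK0, hK⟩ := h6.exists_pot_le hα hF hG hθ1
  have hKs : 0 ≤ ∑ j, K j := Finset.sum_nonneg fun j _ => hK0 j
  -- An energy below `ra + κ = -κ` forces potential energy above `κ`.
  set κ : ℝ := -ra / 2
  have hκ : 0 < κ := by simp only [κ]; linarith
  -- If every normalized excess were below `δ`, the potential energy would be at most `(∑ j, K j) *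
  -- δ < κ`. The gain `δ` exceeds the three errors `δ / 4` from `u`, `v` and the merging.
  set δ : ℝ := κ / (∑ j, K j + 1)
  have hδ : 0 < δ := by positivity
  obtain ⟨u, hu, hJu⟩ := ha (min (δ / 4) κ) (by positivity)
  obtain ⟨v, hv, hJv⟩ := hb (δ / 4) (by positivity)
  have huH := (mem_S_iff.1 hu).1
  have hpot : κ < pot F u := by
    have h1 := min_le_right (δ / 4) κ
    have h2 : 0 ≤ ∑ i, ‖Lam α (u i)‖ ^ 2 := Finset.sum_nonneg fun i _ => by positivity
    rw [J_eq_pot] at hJu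
    have : ra + κ = -κ := by simp only [κ]; ring
    linarith
  obtain ⟨j, hj⟩ : ∃ j, δ ≤ excess F j (θ j) u / θ j ^ 2 := by
    by_contra! hcon
    have h1 : pot F u ≤ (∑ j, K j) * δ := by
      rw [Finset.sum_mul]
      exact (hK u huH).trans (Finset.sum_le_sum fun j _ =>
        mul_le_mul_of_nonneg_left (hcon j).le (hK0 j))
    have h2 : (∑ j, K j + 1) * δ = κ := by
      simp only [δ]; field_simp
    linarith
  have huj : u j ≠ 0 := fun h => by
    have := (mem_S_iff.1 hu).2 j
    rw [h, norm_zero] at this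
    linarith [(hac j).1]
  have hvj : v j ≠ 0 := fun h => by
    have := (mem_S_iff.1 hv).2 j
    rw [h, norm_zero, Pi.sub_apply] at this
    linarith [(hac j).2]
  obtain ⟨z, hz, hzn, hJz⟩ := exists_merge_excess hα hF hG h6.H3 huH (mem_S_iff.1 hv).1 huj hvj
    (θ := θ j) (by rw [norm_sq_add_eq hu hv, (mem_S_iff.1 hu).2, hθ2])
    (show 0 < δ / 4 by positivity)
  have := hc z (mem_S_iff.2 ⟨hz, fun i => (hzn i).trans (norm_sq_add_eq hu hv i)⟩)
  have h1 := min_le_left (δ / 4) κ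
  linarith

end FracSystem

end

theorem lemma2p3 (N m : ℕ) (α : ℝ) (hN : 1 ≤ N) (hm : 2 ≤ m) (hα : (N : ℝ) / 2 < α) :
    (∀ F : FracSystem.RN N → (Fin m → ℝ) → ℝ,
      FracSystem.Caratheodory F → FracSystem.H1 α F → FracSystem.H2 α F → FracSystem.H3 F →
      ∀ a c : Fin m → ℝ, (∀ i, 0 < a i ∧ a i < c i) →
        FracSystem.I α F c ≤ FracSystem.I α F a + FracSystem.I α F (c - a)) ∧
    (∀ Finf : FracSystem.RN N → (Fin m → ℝ) → ℝ,
      FracSystem.Caratheodory Finf → FracSystem.Periodic Finf →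
      FracSystem.H2 α Finf → FracSystem.H5 α Finf → FracSystem.H6 Finf →
      ∀ a c : Fin m → ℝ, (∀ i, 0 < a i ∧ a i < c i) →
        FracSystem.I α Finf c < FracSystem.I α Finf a + FracSystem.I α Finf (c - a)) :=
  ⟨fun _ hF h1 h2 h3 _ _ hac => FracSystem.I_le_add hN hα hF h1.growth h2 h3 hac,
    fun _ hF _ h2 h5 h6 _ _ hac => FracSystem.I_lt_add hN hα hF h5.growth h2 h6 hac⟩
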